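/- Let $U$ be a Banach space with a normalized, $1$-unconditional Schauder basis $(e_n)_{n\in\mathbb N}$ (that is, $\|e_n\|=1$ for all $n$ and $\|\sum_n \sigma_n a_n e_n\|=\|\sum_n a_n e_n\|$ for all finitely supported scalar sequences $(a_n)$ and all signs $\sigma_n=\pm1$), and let $(X_n)$ be a sequence of separable Banach spaces over the same scalar field ($\mathbb R$ or $\mathbb C$). Let $X=(\bigoplus_n X_n)_U$ be the space of all sequences $(x_n)$ with $x_n\in X_n$ such that $\sum_n\|x_n\|e_n$ converges in $U$, with norm $\|(x_n)\|=\bigl\|\sum_n\|x_n\|e_n\bigr\|$. Then $$Sz(X)\leqslant\Bigl(\sup_n Sz(X_n)\Bigr)\cdot Sz(U),$$ where the product is ordinal multiplication. Here the Szlenk index is defined as follows. For a Banach space $Y$, a bounded set $L\subset Y^*$ and $\varepsilon>0$, let $s_\varepsilon(L)$ be the set of all $y^*\in Y^*$ such that $\operatorname{diam}_{\|\cdot\|}(V\cap L)>\varepsilon$ for every weak$^*$ neighbourhood $V$ of $y^*$. Put $s^0_\varepsilon(L)=L$, $s^{\xi+1}_\varepsilon(L)=s_\varepsilon(s^\xi_\varepsilon(L))$,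 and $s^\xi_\varepsilon(L)=\bigcap_{\zeta<\xi}s^\zeta_\varepsilon(L)$ for limit ordinals $\xi$. Let $Sz_\varepsilon(L)$ be the least $\xi<\omega_1$ with $s^\xi_\varepsilon(L)=\varnothing$ if such a $\xi$ exists, and $Sz_\varepsilon(L)=\omega_1$ otherwise. Finally, $Sz(L)=\sup_{\varepsilon>0}Sz_\varepsilon(L)$ and $Sz(Y)=Sz(B_{Y^*})$, where $B_{Y^*}$ is the closed unit ball of $Y^*$. -/

import Mathlib

open Filter Topology
open scoped Ordinal

noncomputable section

/-! ### The Szlenk index -/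

section Szlenk

variable {𝕜 : Type*} [RCLike 𝕜] {X : Type*} [NormedAddCommGroup X] [NormedSpace 𝕜 X]

/-- The Szlenk derivation `s_ε(L)`: all functionals `f` such that every weak* neighbourhood `V`
of `f` meets `L` in a set of norm diameter greater than `ε`. -/
def szlenkDerivation (ε : ℝ) (L : Set (StrongDual 𝕜 X)) : Set (StrongDual 𝕜 X) :=
  {f | ∀ V ∈ 𝓝 (StrongDual.toWeakDual f),
    ENNReal.ofReal ε < Metric.ediam ((StrongDual.toWeakDual ⁻¹' V) ∩ L)}

/-- The transfinite iterates `s_ε^ξ(L)`: intersections are taken at limit ordinals. -/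
def szlenkDerivative (ε : ℝ) (L : Set (StrongDual 𝕜 X)) (ξ : Ordinal.{0}) :
    Set (StrongDual 𝕜 X) :=
  Ordinal.limitRecOn (motive := fun _ => Set (StrongDual 𝕜 X)) ξ L
    (fun _ A => szlenkDerivation ε A)
    (fun o _ A => ⋂ (ζ : Ordinal.{0}) (h : ζ < o), A ζ h)

theorem szlenkDerivative_zero (ε : ℝ) (L : Set (StrongDual 𝕜 X)) :
    szlenkDerivative ε L 0 = L := by
  simp [szlenkDerivative]

theorem szlenkDerivative_add_one (ε : ℝ) (L : Set (StrongDual 𝕜 X)) (ξ : Ordinal.{0}) :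
    szlenkDerivative ε L (ξ + 1) = szlenkDerivation ε (szlenkDerivative ε L ξ) := by
  simp [szlenkDerivative]

theorem szlenkDerivative_limit (ε : ℝ) (L : Set (StrongDual 𝕜 X)) (ξ : Ordinal.{0})
    (hξ : Order.IsSuccLimit ξ) :
    szlenkDerivative ε L ξ = ⋂ (ζ : Ordinal.{0}) (_ : ζ < ξ), szlenkDerivative ε L ζ := by
  rw [szlenkDerivative, Ordinal.limitRecOn_limit _ _ _ _ hξ]
  rfl

/-- `Sz_ε(L)`: the least countable ordinal `ξ` with `s_ε^ξ(L) = ∅` if there is one, and `ω₁`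
otherwise. -/
def szlenkEps (ε : ℝ) (L : Set (StrongDual 𝕜 X)) : Ordinal.{0} :=
  sInf (insert ω₁ {ξ : Ordinal.{0} | ξ < ω₁ ∧ szlenkDerivative ε L ξ = ∅})

/-- `Sz(L) = sup_{ε > 0} Sz_ε(L)`. -/
def szlenkSet (L : Set (StrongDual 𝕜 X)) : Ordinal.{0} :=
  ⨆ ε : {ε : ℝ // 0 < ε}, szlenkEps (ε : ℝ) L

/-- The Szlenk index of a normed space, `Sz(X) = Sz(B_{X*})`. -/
def szlenkIndex (𝕜 : Type*) [RCLike 𝕜] (X : Type*) [NormedAddCommGroup X] [NormedSpace 𝕜 X] :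
    Ordinal.{0} :=
  szlenkSet (Metric.closedBall (0 : StrongDual 𝕜 X) 1)

end Szlenk

/-! ### Normalized `1`-unconditional bases and direct sums along them -/

/-- A normalized, `1`-unconditional (Schauder) basis: changing signs of coefficients does not
change the norm of finite linear combinations of basis vectors. -/
structure NormalizedOneUnconditionalBasis (𝕜 : Type*) (U : Type*) [RCLike 𝕜]
    [NormedAddCommGroup U] [NormedSpace 𝕜 U] where
  /-- The underlying Schauder basis. -/
  toSchauder : SchauderBasis 𝕜 U
  norm_basis : ∀ n : ℕ, ‖toSchauder n‖ = 1
  norm_sign : ∀ (s : Finset ℕ) (a σ : ℕ → 𝕜), (∀ n, σ n = 1 ∨ σ n = -1) →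
    ‖∑ n ∈ s, (σ n * a n) • toSchauder n‖ = ‖∑ n ∈ s, a n • toSchauder n‖

namespace NormalizedOneUnconditionalBasis

variable {𝕜 : Type*} [RCLike 𝕜] {U : Type*} [NormedAddCommGroup U] [NormedSpace 𝕜 U]

theorem norm_sum_update_le (e : NormalizedOneUnconditionalBasis 𝕜 U) (s : Finset ℕ)
    (c : ℕ → ℝ) (k : ℕ) (t : ℝ) (ht : 0 ≤ t) (htc : t ≤ c k) :
    ‖∑ n ∈ s, ((Function.update c k t n : ℝ) : 𝕜) • e.toSchauder n‖ ≤
      ‖∑ n ∈ s, ((c n : ℝ) : 𝕜) • e.toSchauder n‖ := by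
  rcases (ht.trans htc).eq_or_lt with h0 | hpos
  · have : Function.update c k t = c := by
      rw [show t = c k by linarith, Function.update_eq_self]
    rw [this]
  set l : ℝ := (1 + t / c k) / 2 with hl
  have hq0 : 0 ≤ t / c k := div_nonneg ht hpos.le
  have hq1 : t / c k ≤ 1 := (div_le_one hpos).2 htc
  set σ : ℕ → 𝕜 := fun n => if n = k then -1 else 1 with hσ
  have hsig := e.norm_sign s (fun n => ((c n : ℝ) : 𝕜)) σ (fun n => by
    by_cases h : n = k <;> simp [hσ, h])
  have hdec : ∑ n ∈ s, ((Function.update c k t n : ℝ) : 𝕜) • e.toSchauder n =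
      (l : 𝕜) • ∑ n ∈ s, ((c n : ℝ) : 𝕜) • e.toSchauder n +
      ((1 - l : ℝ) : 𝕜) • ∑ n ∈ s, (σ n * ((c n : ℝ) : 𝕜)) • e.toSchauder n := by
    rw [Finset.smul_sum, Finset.smul_sum, ← Finset.sum_add_distrib]
    refine Finset.sum_congr rfl fun n _ => ?_
    rw [smul_smul, smul_smul, ← add_smul]
    congr 1
    by_cases h : n = k
    · subst h
      have hcn : c n ≠ 0 := hpos.ne'
      have : t = l * c n + (1 - l) * (-1 * c n) := by
        rw [hl]; field_simp; ring
      simp only [hσ, Function.update_self, if_true]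
      conv_lhs => rw [this]
      push_cast
      ring
    · simp only [hσ, Function.update_of_ne h, if_neg h]
      push_cast
      ring
  rw [hdec]
  refine (norm_add_le _ _).trans ?_
  rw [norm_smul, norm_smul, hsig, RCLike.norm_ofReal, RCLike.norm_ofReal,
    abs_of_nonneg (by rw [hl]; linarith), abs_of_nonneg (by rw [hl]; linarith), ← add_mul]
  simp

theorem norm_sum_mono (e : NormalizedOneUnconditionalBasis 𝕜 U) (s : Finset ℕ)
    (a b : ℕ → ℝ) (ha : ∀ n, 0 ≤ a n) (hab : ∀ n, a n ≤ b n) :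
    ‖∑ n ∈ s, ((a n : ℝ) : 𝕜) • e.toSchauder n‖ ≤
      ‖∑ n ∈ s, ((b n : ℝ) : 𝕜) • e.toSchauder n‖ := by
  classical
  have key : ∀ t : Finset ℕ,
      ‖∑ n ∈ s, (((if n ∈ t then a n else b n) : ℝ) : 𝕜) • e.toSchauder n‖ ≤
      ‖∑ n ∈ s, ((b n : ℝ) : 𝕜) • e.toSchauder n‖ := by
    intro t
    induction t using Finset.induction_on with
    | empty => simp
    | insert k t hk ih =>
      refine le_trans (le_of_eq ?_) ((e.norm_sum_update_le s
        (fun n => if n ∈ t then a n else b n) k (a k) (ha k) (by simp [hk, hab k])).trans ih)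
      congr 1
      refine Finset.sum_congr rfl fun n _ => ?_
      by_cases h : n = k
      · subst h; simp
      · simp [h]
  refine le_trans (le_of_eq ?_) (key s)
  congr 1
  refine Finset.sum_congr rfl fun n hn => ?_
  simp [hn]

end NormalizedOneUnconditionalBasis

section USum

variable {𝕜 : Type*} [RCLike 𝕜] {U : Type*} [NormedAddCommGroup U] [NormedSpace 𝕜 U]
  (e : NormalizedOneUnconditionalBasis 𝕜 U)
  (X : ℕ → Type*) [∀ n, NormedAddCommGroup (X n)] [∀ n, NormedSpace 𝕜 (X n)]

/-- The terms `‖x_n‖ e_n` of the series attached to a sequence `x = (x_n)`. -/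
def uTerm {X : ℕ → Type*} [∀ n, NormedAddCommGroup (X n)] (x : ∀ n, X n) (n : ℕ) : U :=
  ((‖x n‖ : ℝ) : 𝕜) • e.toSchauder n

theorem uTerm_hasSum_iff {f : ℕ → U} {u : U} :
    HasSum f u (SummationFilter.conditional ℕ) ↔
      Tendsto (fun N => ∑ n ∈ Finset.range N, f n) atTop (𝓝 u) := by
  rw [HasSum, SummationFilter.conditional_filter_eq_map_range, tendsto_map'_iff]
  rfl

theorem uTerm_add_le {X : ℕ → Type*} [∀ n, NormedAddCommGroup (X n)] (x y : ∀ n, X n) (s : Finset ℕ) :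
    ‖∑ n ∈ s, uTerm e (x + y) n‖ ≤ ‖∑ n ∈ s, uTerm e x n‖ + ‖∑ n ∈ s, uTerm e y n‖ := by
  refine (e.norm_sum_mono s (fun n => ‖(x + y) n‖) (fun n => ‖x n‖ + ‖y n‖)
    (fun n => norm_nonneg _) (fun n => norm_add_le _ _)).trans ?_
  refine le_trans (le_of_eq ?_) (norm_add_le _ _)
  rw [← Finset.sum_add_distrib]
  congr 1
  refine Finset.sum_congr rfl fun n _ => ?_
  simp only [uTerm]
  push_cast
  rw [add_smul]

theorem uTerm_smul (c : 𝕜) (x : ∀ n, X n) :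
    uTerm e (c • x) = fun n => ((‖c‖ : ℝ) : 𝕜) • uTerm e x n := by
  funext n
  simp [uTerm, norm_smul, smul_smul]

theorem uTerm_summable_add {X : ℕ → Type*} [∀ n, NormedAddCommGroup (X n)]
    [CompleteSpace U] {x y : ∀ n, X n}
    (hx : Summable (uTerm e x) (SummationFilter.conditional ℕ))
    (hy : Summable (uTerm e y) (SummationFilter.conditional ℕ)) :
    Summable (uTerm e (x + y)) (SummationFilter.conditional ℕ) := by
  obtain ⟨u, hu⟩ := hx
  obtain ⟨v, hv⟩ := hy
  rw [uTerm_hasSum_iff] at hu hv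
  have hC : CauchySeq (fun N => ∑ n ∈ Finset.range N, uTerm e (x + y) n) := by
    rw [Metric.cauchySeq_iff']
    intro δ hδ
    obtain ⟨N₁, h₁⟩ := Metric.cauchySeq_iff.1 hu.cauchySeq (δ / 4) (by positivity)
    obtain ⟨N₂, h₂⟩ := Metric.cauchySeq_iff.1 hv.cauchySeq (δ / 4) (by positivity)
    refine ⟨max N₁ N₂, fun n hn => ?_⟩
    have e₁ := h₁ n (le_trans (le_max_left _ _) hn) (max N₁ N₂) (le_max_left _ _)
    have e₂ := h₂ n (le_trans (le_max_right _ _) hn) (max N₁ N₂) (le_max_right _ _)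
    rw [dist_eq_norm, ← Finset.sum_Ico_eq_sub _ hn] at e₁ e₂ ⊢
    have := uTerm_add_le e x y (Finset.Ico (max N₁ N₂) n)
    linarith
  obtain ⟨w, hw⟩ := cauchySeq_tendsto_of_complete hC
  exact ⟨w, uTerm_hasSum_iff.2 hw⟩

/-- The vector space of all sequences `(x_n)`, `x_n ∈ X_n`, such that `∑ ‖x_n‖ e_n` converges
in `U`. -/
def uSumSubmodule [CompleteSpace U] : Submodule 𝕜 (∀ n, X n) where
  carrier := {x | Summable (uTerm e x) (SummationFilter.conditional ℕ)}
  add_mem' := fun hx hy => uTerm_summable_add e hx hy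
  zero_mem' := by
    have : uTerm e (0 : ∀ n, X n) = fun _ => 0 := by
      funext n; simp [uTerm]
    simp only [Set.mem_ofPred_eq, this]
    exact summable_zero
  smul_mem' := fun c x hx => by
    simp only [Set.mem_ofPred_eq] at hx ⊢
    rw [uTerm_smul]
    exact hx.const_smul _

/-- The direct sum `(⊕ X_n)_U` along the basis `e` of `U`. -/
def USum [CompleteSpace U] : Type _ := uSumSubmodule e X

namespace USum

variable [CompleteSpace U]

instance : AddCommGroup (USum e X) := inferInstanceAs (AddCommGroup (uSumSubmodule e X))

instance : Module 𝕜 (USum e X) := inferInstanceAs (Module 𝕜 (uSumSubmodule e X))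

/-- The norm `‖(x_n)‖ = ‖∑ ‖x_n‖ e_n‖`. -/
instance : Norm (USum e X) :=
  ⟨fun x => ‖∑'[SummationFilter.conditional ℕ] n, uTerm e x.1 n‖⟩

theorem tendsto_norm (x : USum e X) :
    Tendsto (fun N => ‖∑ n ∈ Finset.range N, uTerm e x.1 n‖) atTop (𝓝 ‖x‖) :=
  (uTerm_hasSum_iff.1 (Summable.hasSum x.2)).norm

theorem normedSpaceCore : NormedSpace.Core 𝕜 (USum e X) where
  norm_nonneg x := norm_nonneg (∑'[SummationFilter.conditional ℕ] n, uTerm e x.1 n)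
  norm_smul c x := by
    refine tendsto_nhds_unique (tendsto_norm e X (c • x)) ?_
    refine ((tendsto_norm e X x).const_mul ‖c‖).congr fun N => ?_
    have : uTerm e (c • x).1 = fun n => ((‖c‖ : ℝ) : 𝕜) • uTerm e x.1 n := uTerm_smul e X c x.1
    rw [this, ← Finset.smul_sum, norm_smul]
    simp
  norm_triangle x y :=
    le_of_tendsto_of_tendsto' (tendsto_norm e X (x + y))
      ((tendsto_norm e X x).add (tendsto_norm e X y))
      fun N => uTerm_add_le e x.1 y.1 (Finset.range N)
  norm_eq_zero_iff x := by
    constructor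
    · intro h
      have hs := uTerm_hasSum_iff.1 (Summable.hasSum x.2)
      have h0 : ∑'[SummationFilter.conditional ℕ] n, uTerm e x.1 n = 0 := norm_eq_zero.1 h
      rw [h0] at hs
      refine Subtype.ext (funext fun k => ?_)
      have hk := ((e.toSchauder.coord k).continuous.tendsto 0).comp hs
      rw [map_zero] at hk
      have hk' : Tendsto (fun _ : ℕ => ((‖x.1 k‖ : ℝ) : 𝕜)) atTop (𝓝 0) := by
        refine hk.congr' ?_
        filter_upwards [eventually_gt_atTop k] with N hN
        simp [uTerm, e.toSchauder.ortho, Pi.single_apply, hN]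
      have := tendsto_nhds_unique hk' tendsto_const_nhds
      have h1 : x.1 k = 0 := by simpa using this.symm
      exact h1
    · rintro rfl
      have : uTerm e (0 : USum e X).1 = fun _ => 0 := by
        funext n
        have : (0 : USum e X).1 n = 0 := rfl
        simp [uTerm, this]
      change ‖∑'[SummationFilter.conditional ℕ] n, uTerm e (0 : USum e X).1 n‖ = 0
      rw [this]
      simp

instance : NormedAddCommGroup (USum e X) := NormedAddCommGroup.ofCore (normedSpaceCore e X)

instance : NormedSpace 𝕜 (USum e X) := NormedSpace.ofCore (normedSpaceCore e X)

end USum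

end USum

end

/-! ### Calculus of Szlenk derivatives -/

section Derivatives

variable {𝕜 : Type*} [RCLike 𝕜] {X : Type*} [NormedAddCommGroup X] [NormedSpace 𝕜 X]

/-! Write θ for the supremum of the Szlenk indices of the summands and β for that of U. Up to a
factor 2 in ε, emptiness of the θ-th ε-derivative of a dual ball is the same as the existence of a
rank with values below θ: a weak* upper semicontinuous ordinal function such that points near f of
the same rank as f are within ε of f in norm (`exists_isSzlenkRank`,
`IsSzlenkRank.szlenkDerivative_eq_empty`). So, when θ and β are countable, it suffices to combine
ranks ρ < β on the ball of U* and r_n < θ on the balls of the X_n* into a rank below θ·β on the ball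
of the dual of the sum.

A functional F in that ball restricts to X_n as 4 t(e_n) z_n, with t and z_n in the dual balls. The
triples (t, (z_n), F) form a compact space mapping continuously onto the ball. On it put R = θ·ρ(t)
+ the natural (Hessenberg) sum of r_n(z_n) over n < N(t), where the tail of t beyond N(t) is small.
If R does not drop at a nearby triple, then ρ(t) is unchanged, so t moves little; strict
monotonicity of the natural sum then leaves each r_n(z_n) with n < N(t) unchanged, so these z_n move
little; the other z_n are weighted by a small tail. Taking the maximum of R over fibres gives a rank
on the ball itself.

Two further facts make this work. Small tails exist because a rank on the ball of U* forces the
basis to be shrinking up to δ (`exists_tailLE`). Natural sums of ordinals below θ stay below θ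
because every Szlenk index, hence also θ, is additively principal (`isPrincipal_add_szlenkIndex`).
-/

/-- A set of functionals is weak*-closed. -/
def IsWeakStarClosed (A : Set (StrongDual 𝕜 X)) : Prop :=
  IsClosed (WeakDual.toStrongDual ⁻¹' A : Set (WeakDual 𝕜 X))

theorem isWeakStarClosed_closedBall (r : ℝ) :
    IsWeakStarClosed (Metric.closedBall (0 : StrongDual 𝕜 X) r) :=
  WeakDual.isClosed_closedBall 0 r

theorem szlenkDerivation_mono {ε ε' : ℝ} (h : ε' ≤ ε) {A A' : Set (StrongDual 𝕜 X)}
    (hA : A ⊆ A') : szlenkDerivation ε A ⊆ szlenkDerivation ε' A' := fun _ hf V hV =>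
  (ENNReal.ofReal_le_ofReal h).trans_lt
    ((hf V hV).trans_le (Metric.ediam_mono (Set.inter_subset_inter_right _ hA)))

theorem isWeakStarClosed_szlenkDerivation (ε : ℝ) (A : Set (StrongDual 𝕜 X)) :
    IsWeakStarClosed (szlenkDerivation ε A) := by
  rw [IsWeakStarClosed, ← isOpen_compl_iff, isOpen_iff_mem_nhds]
  intro f hf
  have hf' : ∃ V ∈ 𝓝 f, ¬ ENNReal.ofReal ε <
      Metric.ediam ((StrongDual.toWeakDual ⁻¹' V) ∩ A) := by
    by_contra! h
    exact hf h
  obtain ⟨V, hV, hVA⟩ := hf'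
  filter_upwards [eventually_mem_nhds_iff.2 hV] with g hg hgA
  exact hVA (hgA V hg)

theorem szlenkDerivation_subset (ε : ℝ) {A : Set (StrongDual 𝕜 X)} (hA : IsWeakStarClosed A) :
    szlenkDerivation ε A ⊆ A := by
  intro f hf
  by_contra hfA
  have hV : (WeakDual.toStrongDual ⁻¹' A : Set (WeakDual 𝕜 X))ᶜ ∈ 𝓝 (StrongDual.toWeakDual f) :=
    hA.isOpen_compl.mem_nhds hfA
  have hem : StrongDual.toWeakDual ⁻¹' (WeakDual.toStrongDual ⁻¹' A : Set (WeakDual 𝕜 X))ᶜ ∩ A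
      = ∅ := by
    ext g
    simp
  have := hf _ hV
  rw [hem] at this
  simp at this

theorem isWeakStarClosed_szlenkDerivative (ε : ℝ) {A : Set (StrongDual 𝕜 X)}
    (hA : IsWeakStarClosed A) (ξ : Ordinal.{0}) : IsWeakStarClosed (szlenkDerivative ε A ξ) := by
  induction ξ using Ordinal.limitRecOn with
  | zero => rwa [szlenkDerivative_zero]
  | add_one ξ _ =>
    rw [szlenkDerivative_add_one]
    exact isWeakStarClosed_szlenkDerivation _ _
  | limit ξ hξ ih =>
    rw [szlenkDerivative_limit _ _ _ hξ, IsWeakStarClosed]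
    simp only [Set.preimage_iInter]
    exact isClosed_iInter fun ζ => isClosed_iInter fun hζ => ih ζ hζ

theorem szlenkDerivative_antitone (ε : ℝ) {A : Set (StrongDual 𝕜 X)}
    (hA : IsWeakStarClosed A) : Antitone (szlenkDerivative ε A) := by
  intro ξ η
  induction η using Ordinal.limitRecOn with
  | zero =>
    intro h
    rw [nonpos_iff_eq_zero.1 h]
  | add_one η ih =>
    intro h
    rcases h.eq_or_lt with rfl | h
    · exact le_rfl
    · rw [szlenkDerivative_add_one]
      exact (szlenkDerivation_subset ε (isWeakStarClosed_szlenkDerivative ε hA η)).trans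
        (ih (Order.lt_add_one_iff.1 h))
  | limit η hη ih =>
    intro h
    rcases h.eq_or_lt with rfl | h
    · exact le_rfl
    · rw [szlenkDerivative_limit _ _ _ hη]
      exact Set.biInter_subset_of_mem h

/-- At a limit η every ordinal below ξ + η lies below some ξ + ζ' with ζ' < η, so antitonicity
suffices. This is how stages are added in the doubling argument. -/
theorem szlenkDerivative_szlenkDerivative_subset (ε : ℝ) {A : Set (StrongDual 𝕜 X)}
    (hA : IsWeakStarClosed A) (ξ η : Ordinal.{0}) :
    szlenkDerivative ε (szlenkDerivative ε A ξ) η ⊆ szlenkDerivative ε A (ξ + η) := by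
  induction η using Ordinal.limitRecOn with
  | zero => simp [szlenkDerivative_zero]
  | add_one η ih =>
    rw [← add_assoc]
    simp only [szlenkDerivative_add_one]
    exact szlenkDerivation_mono le_rfl ih
  | limit η hη ih =>
    rw [szlenkDerivative_limit _ _ _ hη,
      szlenkDerivative_limit _ _ _ (Ordinal.isSuccLimit_add ξ hη)]
    refine Set.subset_iInter₂ fun ζ hζ => ?_
    obtain ⟨ζ', hζ', hle⟩ := (Ordinal.lt_add_iff hη.ne_bot).1 hζ
    exact (Set.biInter_subset_of_mem hζ').trans
      ((ih ζ' hζ').trans (szlenkDerivative_antitone ε hA hle))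

/-- Szlenk derivatives are compatible with the affine maps `f ↦ c • f + g`. -/
theorem smul_add_mem_szlenkDerivative {ε ε' c : ℝ} (hc : 0 < c) (hε : ε' ≤ c * ε)
    {A A' : Set (StrongDual 𝕜 X)} (g : StrongDual 𝕜 X)
    (hA : ∀ f ∈ A, (c : 𝕜) • f + g ∈ A') (ξ : Ordinal.{0}) :
    ∀ f ∈ szlenkDerivative ε A ξ, (c : 𝕜) • f + g ∈ szlenkDerivative ε' A' ξ := by
  induction ξ using Ordinal.limitRecOn with
  | zero => simpa only [szlenkDerivative_zero]
  | add_one ξ ih =>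
    simp only [szlenkDerivative_add_one]
    intro f hf V hV
    have hcont : Continuous fun k : WeakDual 𝕜 X => (c : 𝕜) • k + StrongDual.toWeakDual g := by
      fun_prop
    have hV' : (fun k : WeakDual 𝕜 X => (c : 𝕜) • k + StrongDual.toWeakDual g) ⁻¹' V ∈
        𝓝 (StrongDual.toWeakDual f) :=
      hcont.continuousAt.preimage_mem_nhds (by simpa using hV)
    have hlt := hf _ hV'
    rw [Metric.ediam] at hlt
    simp only [lt_iSup_iff] at hlt
    obtain ⟨y, hy, z, hz, hyz⟩ := hlt
    have hmem : ∀ y ∈ StrongDual.toWeakDual ⁻¹'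
        ((fun k : WeakDual 𝕜 X => (c : 𝕜) • k + StrongDual.toWeakDual g) ⁻¹' V) ∩
        szlenkDerivative ε A ξ,
        (c : 𝕜) • y + g ∈ (StrongDual.toWeakDual ⁻¹' V) ∩ szlenkDerivative ε' A' ξ :=
      fun y hy => ⟨by simpa using hy.1, ih y hy.2⟩
    refine lt_of_lt_of_le ?_ (Metric.edist_le_ediam_of_mem (hmem y hy) (hmem z hz))
    have hd : dist ((c : 𝕜) • y + g) ((c : 𝕜) • z + g) = c * dist y z := by
      have hs : (c : 𝕜) • y + g - ((c : 𝕜) • z + g) = (c : 𝕜) • (y - z) := by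
        ext x
        simp [mul_sub]
      rw [dist_eq_norm, hs, norm_smul, RCLike.norm_ofReal, abs_of_pos hc, dist_eq_norm]
    rw [edist_dist, ENNReal.ofReal_lt_ofReal_iff'] at hyz ⊢
    rw [hd]
    exact ⟨hε.trans_lt (mul_lt_mul_of_pos_left hyz.1 hc), mul_pos hc hyz.2⟩
  | limit ξ hξ ih =>
    simp only [szlenkDerivative_limit _ _ _ hξ, Set.mem_iInter]
    exact fun f hf ζ hζ => ih ζ hζ f (hf ζ hζ)

end Derivatives

/-! ### The Szlenk index is additively principal -/

section Index

variable {𝕜 : Type*} [RCLike 𝕜] {X : Type*} [NormedAddCommGroup X] [NormedSpace 𝕜 X]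

theorem szlenkEps_le_omega_one (ε : ℝ) (L : Set (StrongDual 𝕜 X)) : szlenkEps ε L ≤ ω₁ :=
  csInf_le' (Set.mem_insert _ _)

theorem szlenkEps_le {ε : ℝ} {L : Set (StrongDual 𝕜 X)} {ξ : Ordinal.{0}}
    (h : szlenkDerivative ε L ξ = ∅) : szlenkEps ε L ≤ ξ := by
  rcases lt_or_ge ξ ω₁ with hξ | hξ
  · exact csInf_le' (Set.mem_insert_of_mem _ ⟨hξ, h⟩)
  · exact (szlenkEps_le_omega_one ε L).trans hξ

/-- Countability of ξ matters: ω₁ is also the default value of the index, and in that case nothing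
is known about the derivative at ω₁. -/
theorem szlenkDerivative_eq_empty {ε : ℝ} {L : Set (StrongDual 𝕜 X)} (hL : IsWeakStarClosed L)
    {ξ : Ordinal.{0}} (hξ : ξ < ω₁) (h : szlenkEps ε L ≤ ξ) : szlenkDerivative ε L ξ = ∅ := by
  have hmem := csInf_mem (Set.insert_nonempty ω₁
    {ξ : Ordinal.{0} | ξ < ω₁ ∧ szlenkDerivative ε L ξ = ∅})
  rcases hmem with h' | h'
  · exact absurd (h'.ge.trans h) hξ.not_ge
  · exact Set.subset_eq_empty (szlenkDerivative_antitone ε hL h) h'.2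

theorem bddAbove_range_szlenkEps (L : Set (StrongDual 𝕜 X)) :
    BddAbove (Set.range fun ε : {ε : ℝ // 0 < ε} => szlenkEps (ε : ℝ) L) :=
  ⟨ω₁, by rintro _ ⟨ε, rfl⟩; exact szlenkEps_le_omega_one _ _⟩

theorem szlenkEps_le_szlenkSet {ε : ℝ} (hε : 0 < ε) (L : Set (StrongDual 𝕜 X)) :
    szlenkEps ε L ≤ szlenkSet L :=
  le_ciSup (bddAbove_range_szlenkEps L) ⟨ε, hε⟩

theorem szlenkSet_le {L : Set (StrongDual 𝕜 X)} {ξ : Ordinal.{0}}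
    (h : ∀ ε : ℝ, 0 < ε → szlenkEps ε L ≤ ξ) : szlenkSet L ≤ ξ := by
  have : Nonempty {ε : ℝ // 0 < ε} := ⟨⟨1, one_pos⟩⟩
  exact ciSup_le fun ε => h ε ε.2

theorem exists_szlenkDerivative_nonempty {L : Set (StrongDual 𝕜 X)} {ξ : Ordinal.{0}}
    (h : ξ < szlenkSet L) : ∃ ε : ℝ, 0 < ε ∧ (szlenkDerivative ε L ξ).Nonempty := by
  by_contra! hne
  exact h.not_ge (szlenkSet_le fun ε hε => szlenkEps_le (hne ε hε))

theorem lt_szlenkSet {L : Set (StrongDual 𝕜 X)} (hL : IsWeakStarClosed L) {ξ : Ordinal.{0}}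
    (hξ : ξ < ω₁) {ε : ℝ} (hε : 0 < ε) (h : (szlenkDerivative ε L ξ).Nonempty) :
    ξ < szlenkSet L := by
  by_contra! hle
  exact h.ne_empty (szlenkDerivative_eq_empty hL hξ ((szlenkEps_le_szlenkSet hε L).trans hle))

variable (𝕜 X) in
theorem szlenkIndex_le_omega_one : szlenkIndex 𝕜 X ≤ ω₁ :=
  szlenkSet_le fun ε _ => szlenkEps_le_omega_one ε _

variable (𝕜 X) in
theorem szlenkIndex_pos : 0 < szlenkIndex 𝕜 X :=
  lt_szlenkSet (isWeakStarClosed_closedBall 1) (Ordinal.omega_pos 1) one_pos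
    ⟨0, by simp [szlenkDerivative_zero]⟩

/-- Convexity and symmetry of the ball B: averaging a point f of the ξ-th derivative with -f puts 0
in it at scale ε/2, and averaging 0 with any g in B puts all of B/2 in it at scale ε/4. The half
ball then survives ξ more derivations, being a scaled copy of B. -/
theorem szlenkDerivative_closedBall_add_self {ε : ℝ} (hε : 0 < ε) {ξ : Ordinal.{0}}
    (h : (szlenkDerivative ε (Metric.closedBall (0 : StrongDual 𝕜 X) 1) ξ).Nonempty) :
    (szlenkDerivative (ε / 4) (Metric.closedBall (0 : StrongDual 𝕜 X) 1) (ξ + ξ)).Nonempty := by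
  set B := Metric.closedBall (0 : StrongDual 𝕜 X) 1 with hB
  have hBc : IsWeakStarClosed B := isWeakStarClosed_closedBall 1
  have hhalf : ‖((1 / 2 : ℝ) : 𝕜)‖ = 1 / 2 := by
    rw [RCLike.norm_ofReal, abs_of_pos (by norm_num)]
  have hhalf_mem : ∀ g ∈ B, ∀ f ∈ B, ((1 / 2 : ℝ) : 𝕜) • f + ((1 / 2 : ℝ) : 𝕜) • g ∈ B := by
    intro g hg f hf
    rw [hB, mem_closedBall_zero_iff] at *
    refine (norm_add_le _ _).trans ?_
    rw [norm_smul, norm_smul, hhalf]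
    linarith
  have hadd : ∀ ε : ℝ, ∀ f ∈ szlenkDerivative ε B ξ, ∀ g ∈ B,
      ((1 / 2 : ℝ) : 𝕜) • f + ((1 / 2 : ℝ) : 𝕜) • g ∈ szlenkDerivative (ε / 2) B ξ :=
    fun ε f hf g hg => smul_add_mem_szlenkDerivative one_half_pos (by linarith) _
      (hhalf_mem g hg) ξ f hf
  obtain ⟨f, hf⟩ := h
  have hfB : f ∈ B := by
    have := szlenkDerivative_antitone ε hBc zero_le hf
    rwa [szlenkDerivative_zero] at this
  have h0 : (0 : StrongDual 𝕜 X) ∈ szlenkDerivative (ε / 2) B ξ := by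
    have := hadd ε f hf (-f) (by simpa [hB] using hfB)
    simpa using this
  have hsub : ∀ g ∈ B, ((1 / 2 : ℝ) : 𝕜) • g + 0 ∈ szlenkDerivative (ε / 4) B ξ := by
    intro g hg
    have := hadd (ε / 2) 0 h0 g hg
    have hz : ((1 / 2 : ℝ) : 𝕜) • (0 : StrongDual 𝕜 X) + ((1 / 2 : ℝ) : 𝕜) • g =
        ((1 / 2 : ℝ) : 𝕜) • g + 0 := by
      ext x
      simp
    rwa [hz, show ε / 2 / 2 = ε / 4 by ring] at this
  exact ⟨_, szlenkDerivative_szlenkDerivative_subset _ hBc ξ ξ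
    (smul_add_mem_szlenkDerivative one_half_pos (by linarith) 0 hsub ξ f hf)⟩

variable (𝕜 X) in
/-- The Szlenk index of a normed space is an additively principal ordinal. -/
theorem isPrincipal_add_szlenkIndex : Ordinal.IsPrincipal (· + ·) (szlenkIndex 𝕜 X) := by
  rw [Ordinal.isPrincipal_add_iff_add_self_lt]
  intro ξ hξ
  obtain ⟨ε, hε, hne⟩ := exists_szlenkDerivative_nonempty hξ
  have hω : ξ < ω₁ := hξ.trans_le (szlenkIndex_le_omega_one 𝕜 X)
  exact lt_szlenkSet (isWeakStarClosed_closedBall 1) (Ordinal.isPrincipal_add_omega 1 hω hω)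
    (by positivity) (szlenkDerivative_closedBall_add_self hε hne)

end Index

/-! ### Rank functions on the dual ball -/

section DualBall

variable (𝕜 : Type*) [RCLike 𝕜] (X : Type*) [NormedAddCommGroup X] [NormedSpace 𝕜 X]

/-- The closed unit ball of the dual space, with the weak* topology. -/
abbrev DualBall : Type _ :=
  ↥(WeakDual.toStrongDual ⁻¹' Metric.closedBall (0 : StrongDual 𝕜 X) 1 : Set (WeakDual 𝕜 X))

instance : CompactSpace (DualBall 𝕜 X) :=
  isCompact_iff_compactSpace.1 (WeakDual.isCompact_closedBall 0 1)

variable {𝕜 X}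

/-- The functional underlying an element of the dual ball. -/
noncomputable def DualBall.toDual (f : DualBall 𝕜 X) : StrongDual 𝕜 X := WeakDual.toStrongDual f.1

/-- The element of the dual ball given by a functional of norm at most one. -/
noncomputable def DualBall.mk (f : StrongDual 𝕜 X) (hf : ‖f‖ ≤ 1) : DualBall 𝕜 X :=
  ⟨StrongDual.toWeakDual f, by simpa using hf⟩

@[simp]
theorem DualBall.toDual_mk (f : StrongDual 𝕜 X) (hf : ‖f‖ ≤ 1) : (DualBall.mk f hf).toDual = f :=
  rfl

theorem DualBall.norm_toDual_le (f : DualBall 𝕜 X) : ‖f.toDual‖ ≤ 1 :=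
  mem_closedBall_zero_iff.1 f.2

theorem DualBall.continuous_eval (x : X) : Continuous fun f : DualBall 𝕜 X => f.toDual x :=
  (WeakDual.eval_continuous x).comp continuous_subtype_val

theorem DualBall.tendsto_iff {α : Type*} {l : Filter α} {u : α → DualBall 𝕜 X}
    {f : DualBall 𝕜 X} :
    Tendsto u l (𝓝 f) ↔ ∀ x, Tendsto (fun a => (u a).toDual x) l (𝓝 (f.toDual x)) := by
  rw [tendsto_subtype_rng, tendsto_iff_forall_eval_tendsto_topDualPairing]
  rfl

/-- A rank function on the dual ball for `ε`: an upper semicontinuous ordinal-valued function whose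
level sets are locally of norm radius at most `ε`. -/
def IsSzlenkRank (ε : ℝ) (ρ : DualBall 𝕜 X → Ordinal.{0}) : Prop :=
  ∀ f, ∀ᶠ g in 𝓝 f, ρ g ≤ ρ f ∧ (ρ g = ρ f → ‖g.toDual - f.toDual‖ ≤ ε)

/-- The first stage missing f cannot be a limit, where derivatives are intersections. The last stage
containing f will serve as its rank. -/
theorem exists_mem_szlenkDerivative_not_mem {ε : ℝ} {A : Set (StrongDual 𝕜 X)}
    {f : StrongDual 𝕜 X} (hf : f ∈ A) {θ : Ordinal.{0}} (h : f ∉ szlenkDerivative ε A θ) :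
    ∃ ξ < θ, f ∈ szlenkDerivative ε A ξ ∧ f ∉ szlenkDerivative ε A (ξ + 1) := by
  induction θ using Ordinal.limitRecOn with
  | zero => exact absurd hf (by rwa [szlenkDerivative_zero] at h)
  | add_one θ ih =>
    by_cases hθ : f ∈ szlenkDerivative ε A θ
    · exact ⟨θ, Order.lt_add_one_iff.2 le_rfl, hθ, h⟩
    · obtain ⟨ξ, hξ, hfξ⟩ := ih hθ
      exact ⟨ξ, hξ.trans (Order.lt_add_one_iff.2 le_rfl), hfξ⟩
  | limit θ hθ ih =>
    simp only [szlenkDerivative_limit _ _ _ hθ, Set.mem_iInter, not_forall] at h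
    obtain ⟨ζ, hζ, hfζ⟩ := h
    obtain ⟨ξ, hξ, hfξ⟩ := ih ζ hζ hfζ
    exact ⟨ξ, hξ.trans hζ, hfξ⟩

/-- If `s_ε^θ(B)` is empty, then there is a rank function with values below `θ`. -/
theorem exists_isSzlenkRank {ε : ℝ} (hε : 0 ≤ ε) {θ : Ordinal.{0}}
    (h : szlenkDerivative ε (Metric.closedBall (0 : StrongDual 𝕜 X) 1) θ = ∅) :
    ∃ ρ : DualBall 𝕜 X → Ordinal.{0}, (∀ f, ρ f < θ) ∧ IsSzlenkRank ε ρ := by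
  have hBc : IsWeakStarClosed (Metric.closedBall (0 : StrongDual 𝕜 X) 1) :=
    isWeakStarClosed_closedBall 1
  choose ρ hρθ hρ hρ' using fun f : DualBall 𝕜 X =>
    exists_mem_szlenkDerivative_not_mem
      (A := Metric.closedBall (0 : StrongDual 𝕜 X) 1) (f := f.toDual) f.2
      (h ▸ Set.notMem_empty f.toDual)
  refine ⟨ρ, hρθ, fun f => ?_⟩
  have hf := hρ' f
  rw [szlenkDerivative_add_one, szlenkDerivation, Set.mem_ofPred_eq] at hf
  push Not at hf
  -- V witnesses that f leaves at the next stage: it meets the derivative at `ρ f` in diameter at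
  -- most ε. Semicontinuity comes separately, from weak* closedness of the derivative at `ρ f + 1`.
  obtain ⟨V, hV, hVd⟩ := hf
  have h1 : ∀ᶠ g : DualBall 𝕜 X in 𝓝 f, g.1 ∈ V := continuous_subtype_val.continuousAt hV
  have h2 : ∀ᶠ g : DualBall 𝕜 X in 𝓝 f,
      g.toDual ∉ szlenkDerivative ε (Metric.closedBall (0 : StrongDual 𝕜 X) 1) (ρ f + 1) :=
    continuous_subtype_val.continuousAt
      ((isWeakStarClosed_szlenkDerivative ε hBc (ρ f + 1)).isOpen_compl.mem_nhds (hρ' f))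
  filter_upwards [h1, h2] with g hg1 hg2
  have hle : ρ g ≤ ρ f := by
    by_contra! hlt
    exact hg2 (szlenkDerivative_antitone ε hBc (Order.add_one_le_of_lt hlt) (hρ g))
  refine ⟨hle, fun heq => ?_⟩
  have hg : g.toDual ∈ StrongDual.toWeakDual ⁻¹' V ∩
      szlenkDerivative ε (Metric.closedBall (0 : StrongDual 𝕜 X) 1) (ρ f) := ⟨hg1, heq ▸ hρ g⟩
  have hf : f.toDual ∈ StrongDual.toWeakDual ⁻¹' V ∩
      szlenkDerivative ε (Metric.closedBall (0 : StrongDual 𝕜 X) 1) (ρ f) :=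
    ⟨(mem_of_mem_nhds hV :), hρ f⟩
  have := (Metric.edist_le_ediam_of_mem hg hf).trans hVd
  rwa [edist_dist, ENNReal.ofReal_le_ofReal_iff hε, dist_eq_norm] at this

/-- A rank function with values below `θ` forces the `θ`-th Szlenk derivative of the dual ball
to be empty. -/
theorem IsSzlenkRank.szlenkDerivative_eq_empty {ε : ℝ} {ρ : DualBall 𝕜 X → Ordinal.{0}}
    (hρ : IsSzlenkRank ε ρ) {θ : Ordinal.{0}} (hθ : ∀ f, ρ f < θ) :
    szlenkDerivative (2 * ε) (Metric.closedBall (0 : StrongDual 𝕜 X) 1) θ = ∅ := by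
  have hBc : IsWeakStarClosed (Metric.closedBall (0 : StrongDual 𝕜 X) 1) :=
    isWeakStarClosed_closedBall 1
  have hB : ∀ ξ : Ordinal.{0}, ∀ f ∈
      szlenkDerivative (2 * ε) (Metric.closedBall (0 : StrongDual 𝕜 X) 1) ξ, ‖f‖ ≤ 1 := by
    intro ξ f hf
    have := szlenkDerivative_antitone _ hBc zero_le hf
    rwa [szlenkDerivative_zero, mem_closedBall_zero_iff] at this
  have key : ∀ ξ : Ordinal.{0}, ∀ f : DualBall 𝕜 X, f.toDual ∈
      szlenkDerivative (2 * ε) (Metric.closedBall (0 : StrongDual 𝕜 X) 1) ξ → ξ ≤ ρ f := by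
    intro ξ
    induction ξ using Ordinal.limitRecOn with
    | zero => exact fun _ _ => zero_le
    | add_one ξ ih =>
      intro f hf
      by_contra! hlt
      have hξ : ρ f = ξ := le_antisymm (Order.lt_add_one_iff.1 hlt) (ih f
        (szlenkDerivative_antitone _ hBc (Order.le_succ ξ) hf))
      have hev := hρ f
      rw [nhds_subtype_eq_comap, eventually_comap] at hev
      rw [szlenkDerivative_add_one] at hf
      -- If f had rank exactly ξ, then by induction and semicontinuity every nearby point of the
      -- ξ-th derivative would have rank ξ too, hence lie within ε of f. The diameter would be at
      -- most 2ε, which is the origin of the factor 2.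
      refine (hf _ hev).not_ge (Metric.ediam_le fun g hg k hk => ?_)
      have hd : ∀ g ∈ StrongDual.toWeakDual ⁻¹' {b : WeakDual 𝕜 X | ∀ g : DualBall 𝕜 X, g.1 = b →
          ρ g ≤ ρ f ∧ (ρ g = ρ f → ‖g.toDual - f.toDual‖ ≤ ε)} ∩
          szlenkDerivative (2 * ε) (Metric.closedBall (0 : StrongDual 𝕜 X) 1) ξ,
          dist g f.toDual ≤ ε := by
        intro g hg
        obtain ⟨hle, hd⟩ := hg.1 (DualBall.mk g (hB ξ g hg.2)) rfl
        rw [dist_eq_norm]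
        exact hd (le_antisymm hle (hξ.trans_le (ih (DualBall.mk g (hB ξ g hg.2)) hg.2)))
      rw [edist_dist]
      refine ENNReal.ofReal_le_ofReal ((dist_triangle_right g k f.toDual).trans ?_)
      linarith [hd g hg, hd k hk]
    | limit ξ hξ ih =>
      intro f hf
      rw [szlenkDerivative_limit _ _ _ hξ] at hf
      by_contra! hlt
      have h1 := hξ.add_one_lt hlt
      exact (Order.lt_add_one_iff.2 le_rfl).not_ge (ih _ h1 f (Set.mem_iInter₂.1 hf _ h1))
  rw [Set.eq_empty_iff_forall_notMem]
  intro f hf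
  exact (hθ (DualBall.mk f (hB θ f hf))).not_ge (key θ _ hf)

end DualBall

/-! ### The Hessenberg sum of ordinals -/

section HessenbergSum

namespace Ordinal

/-- The Hessenberg sum of two ordinals: the least operation that is strictly increasing in each
variable. -/
noncomputable def hessenbergAdd (a b : Ordinal.{0}) : Ordinal.{0} :=
  max (⨆ x : Set.Iio a, hessenbergAdd x.1 b + 1) (⨆ x : Set.Iio b, hessenbergAdd a x.1 + 1)
termination_by (a, b)
decreasing_by
  · exact Prod.Lex.left _ _ x.2
  · exact Prod.Lex.right _ x.2

theorem hessenbergAdd_lt_left {a a' : Ordinal.{0}} (h : a' < a) (b : Ordinal.{0}) :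
    hessenbergAdd a' b < hessenbergAdd a b := by
  rw [hessenbergAdd.eq_1 a b, ← Order.add_one_le_iff]
  exact (Ordinal.le_iSup (fun x : Set.Iio a => hessenbergAdd x.1 b + 1) ⟨a', h⟩).trans
    (le_max_left _ _)

theorem hessenbergAdd_lt_right (a : Ordinal.{0}) {b b' : Ordinal.{0}} (h : b' < b) :
    hessenbergAdd a b' < hessenbergAdd a b := by
  rw [hessenbergAdd.eq_1 a b, ← Order.add_one_le_iff]
  exact (Ordinal.le_iSup (fun x : Set.Iio b => hessenbergAdd a x.1 + 1) ⟨b', h⟩).trans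
    (le_max_right _ _)

theorem hessenbergAdd_le {a b c : Ordinal.{0}} (ha : ∀ a' < a, hessenbergAdd a' b < c)
    (hb : ∀ b' < b, hessenbergAdd a b' < c) : hessenbergAdd a b ≤ c := by
  rw [hessenbergAdd.eq_1 a b]
  exact max_le (Ordinal.iSup_le fun x => Order.add_one_le_of_lt (ha x.1 x.2))
    (Ordinal.iSup_le fun x => Order.add_one_le_of_lt (hb x.1 x.2))

theorem hessenbergAdd_mono {a a' b b' : Ordinal.{0}} (ha : a' ≤ a) (hb : b' ≤ b) :
    hessenbergAdd a' b' ≤ hessenbergAdd a b :=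
  ((monotone_iff_forall_lt.2 fun _ _ h => (hessenbergAdd_lt_left h b').le) ha).trans
    ((monotone_iff_forall_lt.2 fun _ _ h => (hessenbergAdd_lt_right a h).le) hb)

/-- This is why the natural sum is used: ordinary addition is not strictly increasing on the left,
so an unchanged sum would not detect a drop in a summand. -/
theorem eq_of_hessenbergAdd_eq {a a' b b' : Ordinal.{0}} (ha : a' ≤ a) (hb : b' ≤ b)
    (h : hessenbergAdd a' b' = hessenbergAdd a b) : a' = a ∧ b' = b := by
  constructor
  · by_contra hne
    exact (((hessenbergAdd_lt_left (ha.lt_of_ne hne) b').trans_le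
      (hessenbergAdd_mono le_rfl hb)).ne h)
  · by_contra hne
    exact (((hessenbergAdd_lt_right a' (hb.lt_of_ne hne)).trans_le
      (hessenbergAdd_mono ha le_rfl)).ne h)

theorem le_hessenbergAdd (a b : Ordinal.{0}) : a ≤ hessenbergAdd a b := by
  induction a using WellFoundedLT.induction with
  | ind a ih => exact le_of_forall_lt fun c hc => (ih c hc).trans_lt (hessenbergAdd_lt_left hc b)

/-- Lowering an argument lowers either its coefficient of w, which outweighs any remainder since
remainders add up below w, or only its remainder, where strict monotonicity applies. With w = ω ^ α
this is the successor step of `hessenbergAdd_lt_opow`. -/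
theorem hessenbergAdd_mul_add_le {w : Ordinal.{0}}
    (hw : ∀ a < w, ∀ b < w, hessenbergAdd a b < w) (k l : ℕ) {a b : Ordinal.{0}}
    (ha : a < w) (hb : b < w) :
    hessenbergAdd (w * k + a) (w * l + b) ≤ w * (k + l : ℕ) + hessenbergAdd a b := by
  have hw0 : w ≠ 0 := ha.ne_bot
  have hlt : ∀ (m n : ℕ), m < n → ∀ c < w, ∀ d, w * m + c < w * n + d := by
    intro m n hmn c hc d
    calc w * m + c < w * m + w := by gcongr
      _ = w * (m + 1 : ℕ) := by push_cast; rw [mul_add_one]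
      _ ≤ w * n := by gcongr; exact_mod_cast hmn
      _ ≤ w * n + d := le_self_add
  have hsplit : ∀ (n : ℕ) (d c : Ordinal.{0}), d < w → c < w * n + d →
      ∃ (m : ℕ) (x : Ordinal.{0}), x < w ∧ c = w * m + x ∧ (m < n ∨ m = n ∧ x < d) := by
    intro n d c hd hc
    have hq : c / w < (n + 1 : ℕ) := (lt_mul_iff_div_lt hw0).1
      (by simpa using hc.trans (hlt n (n + 1) n.lt_succ_self d hd 0))
    obtain ⟨m, hm⟩ := lt_omega0.1 (hq.trans (natCast_lt_omega0 _))
    have hc' : c = w * m + c % w := by rw [← hm, div_add_mod]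
    refine ⟨m, c % w, mod_lt c hw0, hc', ?_⟩
    by_contra! hcon
    rcases hcon.1.lt_or_eq with h | h
    · exact lt_asymm hc (hc' ▸ hlt n m h d hd _)
    · refine hc.not_ge ?_
      conv_rhs => rw [hc', ← h]
      gcongr
      exact hcon.2 h.symm
  suffices key : ∀ A B : Ordinal.{0}, ∀ (k l : ℕ) (a b : Ordinal.{0}), a < w → b < w →
      A = w * k + a → B = w * l + b →
      hessenbergAdd A B ≤ w * (k + l : ℕ) + hessenbergAdd a b from
    key _ _ k l a b ha hb rfl rfl
  clear ha hb a b k l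
  intro A
  induction A using WellFoundedLT.induction with
  | ind A ihA =>
    intro B
    induction B using WellFoundedLT.induction with
    | ind B ihB =>
      rintro k l a b ha hb hA hB
      refine hessenbergAdd_le (fun A' hA' => ?_) (fun B' hB' => ?_)
      · obtain ⟨m, x, hx, hxA, h | ⟨rfl, h⟩⟩ := hsplit k a A' ha (hA ▸ hA')
        · exact (ihA A' hA' B m l x b hx hb hxA hB).trans_lt
            (hlt _ _ (by omega) _ (hw x hx b hb) _)
        · refine (ihA A' hA' B m l x b hx hb hxA hB).trans_lt ?_
          gcongr
          exact hessenbergAdd_lt_left h b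
      · obtain ⟨m, x, hx, hxB, h | ⟨rfl, h⟩⟩ := hsplit l b B' hb (hB ▸ hB')
        · exact (ihB B' hB' k m a x ha hx hA hxB).trans_lt
            (hlt _ _ (by omega) _ (hw a ha x hx) _)
        · refine (ihB B' hB' k m a x ha hx hA hxB).trans_lt ?_
          gcongr
          exact hessenbergAdd_lt_right a h

theorem hessenbergAdd_lt_opow (α : Ordinal.{0}) :
    ∀ a < ω ^ α, ∀ b < ω ^ α, hessenbergAdd a b < ω ^ α := by
  induction α using Ordinal.limitRecOn with
  | zero =>
    intro a ha b hb
    rw [opow_zero, Order.lt_one_iff] at ha hb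
    subst ha hb
    rw [opow_zero, Order.lt_one_iff]
    exact nonpos_iff_eq_zero.1 (hessenbergAdd_le (by simp) (by simp))
  | add_one α ih =>
    intro a ha b hb
    have hw0 : ω ^ α ≠ 0 := (opow_pos α omega0_pos).ne'
    rw [← Order.succ_eq_add_one, opow_succ] at ha hb ⊢
    obtain ⟨k, hk⟩ := lt_omega0.1 ((lt_mul_iff_div_lt hw0).1 ha)
    obtain ⟨l, hl⟩ := lt_omega0.1 ((lt_mul_iff_div_lt hw0).1 hb)
    have h := hessenbergAdd_mul_add_le ih k l (mod_lt a hw0) (mod_lt b hw0)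
    rw [← hk, ← hl, div_add_mod, div_add_mod] at h
    calc hessenbergAdd a b ≤ _ := h
      _ < ω ^ α * (k + l : ℕ) + ω ^ α := by
        gcongr
        exact ih _ (mod_lt a hw0) _ (mod_lt b hw0)
      _ = ω ^ α * (k + l + 1 : ℕ) := by push_cast; rw [mul_add_one]
      _ ≤ ω ^ α * ω := by gcongr; exact (natCast_lt_omega0 _).le
  | limit α hα ih =>
    intro a ha b hb
    obtain ⟨c, hc, hac⟩ := (lt_opow_of_isSuccLimit omega0_ne_zero hα).1 ha
    obtain ⟨d, hd, hbd⟩ := (lt_opow_of_isSuccLimit omega0_ne_zero hα).1 hb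
    have hmax : max c d < α := max_lt hc hd
    have hle : ∀ {x y : Ordinal.{0}}, x ≤ y → ω ^ x ≤ ω ^ y :=
      fun h => opow_le_opow_right omega0_pos h
    exact (ih _ hmax a (hac.trans_le (hle (le_max_left c d))) b
      (hbd.trans_le (hle (le_max_right c d)))).trans_le (hle hmax.le)

theorem IsPrincipal.hessenbergAdd_lt {θ a b : Ordinal.{0}} (hθ : IsPrincipal (· + ·) θ)
    (ha : a < θ) (hb : b < θ) : hessenbergAdd a b < θ := by
  rcases isPrincipal_add_iff_zero_or_omega0_opow.1 hθ with rfl | ⟨α, rfl⟩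
  · exact absurd ha not_lt_zero
  · exact hessenbergAdd_lt_opow α a ha b hb

/-- The Hessenberg sum of the first `N` terms of a sequence of ordinals. -/
noncomputable def hessenbergSum (r : ℕ → Ordinal.{0}) : ℕ → Ordinal.{0}
  | 0 => 0
  | N + 1 => hessenbergAdd (hessenbergSum r N) (r N)

theorem monotone_hessenbergSum (r : ℕ → Ordinal.{0}) : Monotone (hessenbergSum r) :=
  monotone_nat_of_le_succ fun _ => le_hessenbergAdd _ _

theorem hessenbergSum_le {r r' : ℕ → Ordinal.{0}} {N : ℕ} (h : ∀ n < N, r' n ≤ r n) :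
    hessenbergSum r' N ≤ hessenbergSum r N := by
  induction N with
  | zero => exact le_rfl
  | succ N ih =>
    exact hessenbergAdd_mono (ih fun n hn => h n (hn.trans N.lt_succ_self)) (h N N.lt_succ_self)

theorem eq_of_hessenbergSum_eq {r r' : ℕ → Ordinal.{0}} {N : ℕ} (h : ∀ n < N, r' n ≤ r n)
    (heq : hessenbergSum r' N = hessenbergSum r N) : ∀ n < N, r' n = r n := by
  induction N with
  | zero => simp
  | succ N ih =>
    have h' : ∀ n < N, r' n ≤ r n := fun n hn => h n (hn.trans N.lt_succ_self)
    obtain ⟨h1, h2⟩ := eq_of_hessenbergAdd_eq (hessenbergSum_le h') (h N N.lt_succ_self) heq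
    intro n hn
    rcases Nat.lt_succ_iff_lt_or_eq.1 hn with hn | rfl
    · exact ih h' h1 n hn
    · exact h2

theorem IsPrincipal.hessenbergSum_lt {θ : Ordinal.{0}} (hθ : IsPrincipal (· + ·) θ) (h0 : 0 < θ)
    {r : ℕ → Ordinal.{0}} (hr : ∀ n, r n < θ) (N : ℕ) : hessenbergSum r N < θ := by
  induction N with
  | zero => exact h0
  | succ N ih => exact hθ.hessenbergAdd_lt ih (hr N)

end Ordinal

end HessenbergSum

/-! ### Pushing ranks down along a compact surjection -/

section Lift

/-- Rank functions descend along continuous surjections of compact spaces: the largest rank in the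
fibre is a rank function. -/
theorem exists_isSzlenkRank_of_surjective {𝕜 : Type*} [RCLike 𝕜] {X : Type*}
    [NormedAddCommGroup X] [NormedSpace 𝕜 X] {Ω : Type*} [TopologicalSpace Ω] [CompactSpace Ω]
    {p : Ω → DualBall 𝕜 X} (hp : Continuous p) (hsurj : Function.Surjective p) {ε : ℝ}
    {R : Ω → Ordinal.{0}}
    (hR : ∀ o, ∀ᶠ o' in 𝓝 o, R o' ≤ R o ∧
      (R o' = R o → ‖(p o').toDual - (p o).toDual‖ ≤ ε)) {θ : Ordinal.{0}}
    (hθ : ∀ o, R o < θ) :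
    ∃ ρ : DualBall 𝕜 X → Ordinal.{0}, (∀ f, ρ f < θ) ∧ IsSzlenkRank ε ρ := by
  have husc : UpperSemicontinuous R := fun o c hc =>
    (hR o).mono fun o' h => h.1.trans_lt hc
  have hmax : ∀ f, ∃ o, p o = f ∧ ∀ o', p o' = f → R o' ≤ R o := by
    intro f
    obtain ⟨o, ho, hm⟩ := UpperSemicontinuousOn.exists_isMaxOn (s := p ⁻¹' {f}) (hsurj f)
      (isClosed_singleton.preimage hp).isCompact (husc.upperSemicontinuousOn _)
    exact ⟨o, ho, fun o' ho' => hm ho'⟩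
  choose s hs hsmax using hmax
  refine ⟨fun f => R (s f), fun f => hθ _, fun f => ?_⟩
  by_contra hcon
  have hne := frequently_iff_neBot.1 (not_eventually.1 hcon)
  -- If the condition failed at f, bad points would converge to f along an ultrafilter, and by
  -- compactness their fibre maximizers would converge to some point over f. Its rank is at most
  -- that of `s f`, so the hypothesis on R there contradicts badness.
  obtain ⟨F, hFle⟩ := Ultrafilter.exists_le
    (𝓝 f ⊓ 𝓟 {g | ¬ (R (s g) ≤ R (s f) ∧ (R (s g) = R (s f) → ‖g.toDual - f.toDual‖ ≤ ε))})
  have hlim : Tendsto s F (𝓝 (F.map s).lim) := (F.map s).le_nhds_lim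
  have hpo : p (F.map s).lim = f := by
    refine tendsto_nhds_unique ((hp.tendsto _).comp hlim) ?_
    have : p ∘ s = id := funext hs
    rw [this]
    exact hFle.trans inf_le_left
  have hbad := hFle (mem_inf_of_right (mem_principal_self _))
  obtain ⟨g, hg, hgbad⟩ := ((hlim.eventually (hR (F.map s).lim)).and hbad).exists
  have hle := hsmax f _ hpo
  refine hgbad ⟨hg.1.trans hle, fun heq => ?_⟩
  have := hg.2 (le_antisymm hg.1 (hle.trans heq.ge))
  rwa [hs, hpo] at this

end Lift

/-! ### Unconditionality and small tails of functionals -/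

section Unconditional

/-- A scalar of modulus at most one rotating `z` to the positive real axis. -/
def conjPhase {𝕜 : Type*} [RCLike 𝕜] (z : 𝕜) : 𝕜 := starRingEnd 𝕜 z / (‖z‖ : 𝕜)

theorem conjPhase_mul {𝕜 : Type*} [RCLike 𝕜] (z : 𝕜) : conjPhase z * z = (‖z‖ : 𝕜) := by
  rcases eq_or_ne z 0 with rfl | hz
  · simp [conjPhase]
  · have : (‖z‖ : 𝕜) ≠ 0 := by simpa using hz
    rw [conjPhase, div_mul_eq_mul_div, RCLike.conj_mul, sq, mul_div_assoc, div_self this, mul_one]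

theorem norm_conjPhase_le {𝕜 : Type*} [RCLike 𝕜] (z : 𝕜) : ‖conjPhase z‖ ≤ 1 := by
  rw [conjPhase, norm_div, RCLike.norm_conj, RCLike.norm_ofReal, abs_norm]
  exact div_self_le_one _

namespace NormalizedOneUnconditionalBasis

variable {𝕜 : Type*} [RCLike 𝕜] {U : Type*} [NormedAddCommGroup U] [NormedSpace 𝕜 U]
  (e : NormalizedOneUnconditionalBasis 𝕜 U)

/-- The new vector is a convex combination, with weights (1 ± t)/2, of the old one and its sign
change at k. -/
theorem norm_sum_update_mul_le (s : Finset ℕ) (a : ℕ → 𝕜) (k : ℕ) (t : ℝ) (ht : |t| ≤ 1) :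
    ‖∑ n ∈ s, Function.update a k (t * a k) n • e.toSchauder n‖ ≤
      ‖∑ n ∈ s, a n • e.toSchauder n‖ := by
  set σ : ℕ → 𝕜 := fun n => if n = k then -1 else 1 with hσ
  have hsig := e.norm_sign s a σ (fun n => by by_cases h : n = k <;> simp [hσ, h])
  obtain ⟨ht1, ht2⟩ := abs_le.1 ht
  have hdec : ∑ n ∈ s, Function.update a k (t * a k) n • e.toSchauder n =
      (((1 + t) / 2 : ℝ) : 𝕜) • ∑ n ∈ s, a n • e.toSchauder n +
      (((1 - t) / 2 : ℝ) : 𝕜) • ∑ n ∈ s, (σ n * a n) • e.toSchauder n := by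
    rw [Finset.smul_sum, Finset.smul_sum, ← Finset.sum_add_distrib]
    refine Finset.sum_congr rfl fun n _ => ?_
    rw [smul_smul, smul_smul, ← add_smul]
    congr 1
    by_cases h : n = k
    · subst h
      simp only [hσ, Function.update_self, if_true]
      push_cast
      ring
    · simp only [hσ, Function.update_of_ne h, if_neg h]
      push_cast
      ring
  rw [hdec]
  refine (norm_add_le _ _).trans ?_
  rw [norm_smul, norm_smul, hsig, RCLike.norm_ofReal, RCLike.norm_ofReal,
    abs_of_nonneg (by linarith), abs_of_nonneg (by linarith), ← add_mul]
  exact le_of_eq (by ring)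

theorem norm_sum_ofReal_mul_le (s : Finset ℕ) (c : ℕ → ℝ) (hc : ∀ n, |c n| ≤ 1) (a : ℕ → 𝕜) :
    ‖∑ n ∈ s, ((c n : 𝕜) * a n) • e.toSchauder n‖ ≤ ‖∑ n ∈ s, a n • e.toSchauder n‖ := by
  classical
  have key : ∀ t : Finset ℕ,
      ‖∑ n ∈ s, (if n ∈ t then (c n : 𝕜) * a n else a n) • e.toSchauder n‖ ≤
      ‖∑ n ∈ s, a n • e.toSchauder n‖ := by
    intro t
    induction t using Finset.induction_on with
    | empty => simp
    | insert k t hk ih =>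
      refine le_trans (le_of_eq ?_) ((e.norm_sum_update_mul_le s
        (fun n => if n ∈ t then (c n : 𝕜) * a n else a n) k (c k) (hc k)).trans ih)
      congr 1
      refine Finset.sum_congr rfl fun n _ => ?_
      by_cases h : n = k
      · subst h; simp [hk]
      · simp [h]
  refine le_trans (le_of_eq ?_) (key s)
  congr 1
  exact Finset.sum_congr rfl fun n hn => by rw [if_pos hn]

/-- Only real signs are assumed harmless, so a scalar multiplier is split into real and imaginary
parts, at the cost of the factor 2. -/
theorem norm_sum_mul_le (s : Finset ℕ) (c : ℕ → 𝕜) (hc : ∀ n, ‖c n‖ ≤ 1) (a : ℕ → 𝕜) :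
    ‖∑ n ∈ s, (c n * a n) • e.toSchauder n‖ ≤ 2 * ‖∑ n ∈ s, a n • e.toSchauder n‖ := by
  have h1 := e.norm_sum_ofReal_mul_le s (fun n => RCLike.re (c n))
    (fun n => (RCLike.abs_re_le_norm _).trans (hc n)) a
  have h2 := e.norm_sum_ofReal_mul_le s (fun n => RCLike.im (c n))
    (fun n => (RCLike.abs_im_le_norm _).trans (hc n)) a
  have hdec : ∑ n ∈ s, (c n * a n) • e.toSchauder n =
      ∑ n ∈ s, ((RCLike.re (c n) : 𝕜) * a n) • e.toSchauder n +
      (RCLike.I : 𝕜) • ∑ n ∈ s, ((RCLike.im (c n) : 𝕜) * a n) • e.toSchauder n := by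
    rw [Finset.smul_sum, ← Finset.sum_add_distrib]
    refine Finset.sum_congr rfl fun n _ => ?_
    rw [smul_smul, ← add_smul]
    congr 1
    conv_lhs => rw [← RCLike.re_add_im (c n)]
    ring
  have hI : ‖(RCLike.I : 𝕜)‖ ≤ 1 := by
    by_cases h : (RCLike.I : 𝕜) = 0
    · simp [h]
    · exact (RCLike.norm_I_of_ne_zero h).le
  rw [hdec]
  refine (norm_add_le _ _).trans ?_
  rw [norm_smul]
  have := mul_le_of_le_one_left
    (norm_nonneg (∑ n ∈ s, ((RCLike.im (c n) : 𝕜) * a n) • e.toSchauder n)) hI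
  linarith

theorem norm_sum_norm_le (s : Finset ℕ) (a : ℕ → 𝕜) :
    ‖∑ n ∈ s, (‖a n‖ : 𝕜) • e.toSchauder n‖ ≤ 2 * ‖∑ n ∈ s, a n • e.toSchauder n‖ := by
  have := e.norm_sum_mul_le s (fun n => conjPhase (a n)) (fun n => norm_conjPhase_le _) a
  simpa only [conjPhase_mul] using this

theorem norm_sum_filter_le (s : Finset ℕ) (p : ℕ → Prop) [DecidablePred p] (a : ℕ → ℝ)
    (ha : ∀ n, 0 ≤ a n) :
    ‖∑ n ∈ s with p n, (a n : 𝕜) • e.toSchauder n‖ ≤ ‖∑ n ∈ s, (a n : 𝕜) • e.toSchauder n‖ := by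
  refine le_trans (le_of_eq ?_) (e.norm_sum_mono s (fun n => if p n then a n else 0) a
    (fun n => by split_ifs <;> simp [ha n]) (fun n => by split_ifs <;> simp [ha n]))
  rw [Finset.sum_filter]
  congr 1
  refine Finset.sum_congr rfl fun n _ => ?_
  split_ifs <;> simp

theorem apply_sum_conjPhase (g : StrongDual 𝕜 U) (s : Finset ℕ) (a : ℕ → ℝ) :
    g (∑ n ∈ s, (conjPhase (g (e.toSchauder n)) * (a n : 𝕜)) • e.toSchauder n) =
      ((∑ n ∈ s, ‖g (e.toSchauder n)‖ * a n : ℝ) : 𝕜) := by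
  rw [map_sum]
  push_cast
  refine Finset.sum_congr rfl fun n _ => ?_
  rw [map_smul, smul_eq_mul, mul_right_comm, conjPhase_mul]

theorem sum_norm_apply_mul_le (g : StrongDual 𝕜 U) (s : Finset ℕ) (a : ℕ → ℝ)
    (ha : ∀ n, 0 ≤ a n) :
    ∑ n ∈ s, ‖g (e.toSchauder n)‖ * a n ≤
      2 * ‖g‖ * ‖∑ n ∈ s, (a n : 𝕜) • e.toSchauder n‖ := by
  have h1 := g.le_opNorm
    (∑ n ∈ s, (conjPhase (g (e.toSchauder n)) * (a n : 𝕜)) • e.toSchauder n)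
  rw [e.apply_sum_conjPhase, RCLike.norm_ofReal, abs_of_nonneg
    (Finset.sum_nonneg fun n _ => mul_nonneg (norm_nonneg _) (ha n))] at h1
  have h2 := e.norm_sum_mul_le s (fun n => conjPhase (g (e.toSchauder n)))
    (fun n => norm_conjPhase_le _) (fun n => (a n : 𝕜))
  have := mul_le_mul_of_nonneg_left h2 (norm_nonneg g)
  linarith

/-- The tail of the functional `g` beyond `N` has norm at most `η`, measured on vectors with
nonnegative coefficients. -/
def TailLE (g : StrongDual 𝕜 U) (N : ℕ) (η : ℝ) : Prop :=
  ∀ (s : Finset ℕ) (a : ℕ → ℝ), (∀ n ∈ s, N ≤ n) → (∀ n, 0 ≤ a n) →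
    ∑ n ∈ s, ‖g (e.toSchauder n)‖ * a n ≤ η * ‖∑ n ∈ s, (a n : 𝕜) • e.toSchauder n‖

variable {e} in
theorem TailLE.add {g g' : StrongDual 𝕜 U} {N : ℕ} {η δ : ℝ} (h : e.TailLE g N η)
    (hδ : ‖g' - g‖ ≤ δ) : e.TailLE g' N (η + 2 * δ) := by
  intro s a hs ha
  calc ∑ n ∈ s, ‖g' (e.toSchauder n)‖ * a n
      ≤ ∑ n ∈ s, (‖g (e.toSchauder n)‖ * a n + ‖(g' - g) (e.toSchauder n)‖ * a n) := by
        refine Finset.sum_le_sum fun n _ => ?_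
        rw [← add_mul]
        refine mul_le_mul_of_nonneg_right ?_ (ha n)
        refine le_trans (le_of_eq ?_) (norm_add_le _ _)
        simp
    _ ≤ η * ‖∑ n ∈ s, (a n : 𝕜) • e.toSchauder n‖ +
        2 * ‖g' - g‖ * ‖∑ n ∈ s, (a n : 𝕜) • e.toSchauder n‖ := by
        rw [Finset.sum_add_distrib]
        exact add_le_add (h s a hs ha) (e.sum_norm_apply_mul_le _ s a ha)
    _ ≤ _ := by
        rw [← add_mul]
        gcongr

/-- Changing the signs of the coordinates in a finite set. -/
def signFlip (s : Finset ℕ) : U →L[𝕜] U :=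
  ContinuousLinearMap.id 𝕜 U - (2 : 𝕜) • GeneralSchauderBasis.proj e.toSchauder s

theorem signFlip_basis (s : Finset ℕ) (n : ℕ) :
    e.signFlip s (e.toSchauder n) = (if n ∈ s then -1 else 1 : 𝕜) • e.toSchauder n := by
  classical
  rw [signFlip, sub_apply, smul_apply, GeneralSchauderBasis.proj_apply_basis_mem]
  split_ifs
  · simp only [ContinuousLinearMap.id_apply]
    module
  · simp

theorem norm_signFlip_apply_le (s : Finset ℕ) (u : U) : ‖e.signFlip s u‖ ≤ ‖u‖ := by
  have h1 := SchauderBasis.tendsto_proj e.toSchauder u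
  refine le_of_tendsto_of_tendsto' (((e.signFlip s).continuous.tendsto u).comp h1).norm h1.norm
    fun N => le_of_eq ?_
  simp only [Function.comp_apply, SchauderBasis.proj_apply, map_sum, map_smul, signFlip_basis,
    smul_smul]
  rw [← e.norm_sign (Finset.range N) (fun n => e.toSchauder.coord n u)
    (fun n => if n ∈ s then -1 else 1) (fun n => by split_ifs <;> simp)]
  simp only [mul_comm]

theorem two_smul_proj_apply (s : Finset ℕ) (u : U) :
    (2 : 𝕜) • GeneralSchauderBasis.proj e.toSchauder s u = u - e.signFlip s u := by
  simp [signFlip]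

theorem norm_proj_apply_le (s : Finset ℕ) (u : U) :
    ‖GeneralSchauderBasis.proj e.toSchauder s u‖ ≤ ‖u‖ := by
  have h := congrArg norm (e.two_smul_proj_apply s u)
  rw [norm_smul, RCLike.norm_ofNat] at h
  have := norm_sub_le u (e.signFlip s u)
  have := e.norm_signFlip_apply_le s u
  linarith

/-- The projection onto `s N` kills the N-th partial sum of u, so its value at u is bounded by the
remainder of the expansion. -/
theorem tendsto_signFlip {s : ℕ → Finset ℕ} (hs : ∀ N, ∀ n ∈ s N, N ≤ n) (u : U) :
    Tendsto (fun N => e.signFlip (s N) u) atTop (𝓝 u) := by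
  have h0 : Tendsto (fun N => GeneralSchauderBasis.proj e.toSchauder (s N) u) atTop (𝓝 0) := by
    have h1 := (SchauderBasis.tendsto_proj e.toSchauder u).sub_const u
    rw [sub_self] at h1
    refine squeeze_zero_norm (fun N => ?_) (tendsto_zero_iff_norm_tendsto_zero.1 h1)
    have h2 : GeneralSchauderBasis.proj e.toSchauder (s N)
        (SchauderBasis.proj e.toSchauder N u) = 0 := by
      rw [SchauderBasis.proj_apply, map_sum]
      refine Finset.sum_eq_zero fun n hn => ?_
      rw [map_smul, GeneralSchauderBasis.proj_apply_basis_mem, if_neg, smul_zero]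
      exact fun hn' => (hs N n hn').not_gt (Finset.mem_range.1 hn)
    have h3 := e.norm_proj_apply_le (s N) (u - SchauderBasis.proj e.toSchauder N u)
    rwa [map_sub, h2, sub_zero, norm_sub_rev] at h3
  have := (h0.const_smul (2 : 𝕜)).const_sub u
  simpa [signFlip] using this

/-- If the dual ball of `U` carries a rank function for some `δ`, then the tails of every
functional are eventually small, i.e. the basis is shrinking up to `δ`. -/
theorem exists_tailLE {δ : ℝ} {ρ : DualBall 𝕜 U → Ordinal.{0}} (hρ : IsSzlenkRank δ ρ)
    (t : DualBall 𝕜 U) : ∃ N, e.TailLE t.toDual N δ := by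
  by_contra! hcon
  simp only [TailLE, not_forall, not_le] at hcon
  choose s a hs ha hlt using hcon
  -- Replace t by a functional of least rank with the same coordinate moduli. It has the same large
  -- tails, and sign flips do not leave this class.
  obtain ⟨g, hg, hmin⟩ := (InvImage.wf ρ wellFounded_lt).has_min
    {g : DualBall 𝕜 U | ∀ n, ‖g.toDual (e.toSchauder n)‖ = ‖t.toDual (e.toSchauder n)‖}
    ⟨t, fun _ => rfl⟩
  have hflip : ∀ N, ‖g.toDual ∘L e.signFlip (s N)‖ ≤ 1 := fun N =>
    (g.toDual ∘L e.signFlip (s N)).opNorm_le_bound zero_le_one fun u =>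
      (g.toDual.le_of_opNorm_le g.norm_toDual_le _).trans (by
        simpa using e.norm_signFlip_apply_le (s N) u)
  have htend : Tendsto (fun N => DualBall.mk _ (hflip N)) atTop (𝓝 g) :=
    DualBall.tendsto_iff.2 fun u =>
      (g.toDual.continuous.tendsto u).comp (e.tendsto_signFlip hs u)
  obtain ⟨N, hle, hN⟩ := (htend.eventually (hρ g)).exists
  have hmem : DualBall.mk _ (hflip N) ∈
      {g : DualBall 𝕜 U | ∀ n, ‖g.toDual (e.toSchauder n)‖ = ‖t.toDual (e.toSchauder n)‖} := by
    intro n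
    rw [DualBall.toDual_mk, ContinuousLinearMap.comp_apply, signFlip_basis, map_smul, norm_smul,
      hg n]
    split_ifs <;> simp
  -- The flips converge weak* to g, so eventually their rank is at most that of g; minimality gives
  -- equality, hence norm distance at most δ.
  have hd := hN (le_antisymm hle (not_lt.1 (hmin _ hmem)))
  set v := ∑ n ∈ s N, (conjPhase (g.toDual (e.toSchauder n)) * (a N n : 𝕜)) • e.toSchauder n
    with hv
  have hflipv : e.signFlip (s N) v = -v := by
    rw [hv, map_sum, ← Finset.sum_neg_distrib]
    refine Finset.sum_congr rfl fun n hn => ?_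
    rw [map_smul, signFlip_basis, if_pos hn, neg_one_smul, smul_neg]
  -- The 2 gained here cancels the 2 lost in bounding the norm of v, so the tail bound is exactly δ.
  have hval : (DualBall.mk _ (hflip N)).toDual v - g.toDual v = -(2 * g.toDual v) := by
    rw [DualBall.toDual_mk, ContinuousLinearMap.comp_apply, hflipv, map_neg]
    ring
  have h1 := ((DualBall.mk _ (hflip N)).toDual - g.toDual).le_of_opNorm_le hd v
  rw [sub_apply, hval, norm_neg, norm_mul, RCLike.norm_ofNat, e.apply_sum_conjPhase,
    RCLike.norm_ofReal, abs_of_nonneg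
    (Finset.sum_nonneg fun n _ => mul_nonneg (norm_nonneg _) (ha N n))] at h1
  simp only [hg _] at h1
  have h2 := e.norm_sum_mul_le (s N) (fun n => conjPhase (g.toDual (e.toSchauder n)))
    (fun n => norm_conjPhase_le _) (fun n => (a N n : 𝕜))
  have hδ : 0 ≤ δ := (norm_nonneg _).trans hd
  have h3 := mul_le_mul_of_nonneg_left h2 hδ
  have h4 := hlt N
  rw [← hv] at h3
  linarith

end NormalizedOneUnconditionalBasis

end Unconditional

/-! ### Finitely supported vectors in the direct sum -/

namespace USum

theorem hasSum_uTerm_of_eventually_zero {𝕜 : Type*} [RCLike 𝕜] {U : Type*}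
    [NormedAddCommGroup U] [NormedSpace 𝕜 U] (e : NormalizedOneUnconditionalBasis 𝕜 U)
    {X : ℕ → Type*} [∀ n, NormedAddCommGroup (X n)] {x : ∀ n, X n} {N : ℕ}
    (hx : ∀ n, N ≤ n → x n = 0) :
    HasSum (uTerm e x) (∑ n ∈ Finset.range N, uTerm e x n) (SummationFilter.conditional ℕ) := by
  rw [uTerm_hasSum_iff]
  refine tendsto_const_nhds.congr' ?_
  filter_upwards [eventually_ge_atTop N] with M hM
  refine Finset.sum_subset (Finset.range_mono hM) fun n _ hn => ?_
  simp [uTerm, hx n (by simpa using hn)]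

variable {𝕜 : Type*} [RCLike 𝕜] {U : Type*} [NormedAddCommGroup U] [NormedSpace 𝕜 U]
  [CompleteSpace U] (e : NormalizedOneUnconditionalBasis 𝕜 U)
  {X : ℕ → Type*} [∀ n, NormedAddCommGroup (X n)] [∀ n, NormedSpace 𝕜 (X n)]

/-- The vector of the direct sum with the single nonzero coordinate `v` at `k`. -/
def single (k : ℕ) (v : X k) : USum e X :=
  ⟨Pi.single k v, _, hasSum_uTerm_of_eventually_zero e (N := k + 1) fun n hn =>
    Pi.single_eq_of_ne (by omega) v⟩

@[simp]
theorem single_val (k : ℕ) (v : X k) : (single e k v).1 = Pi.single k v := rfl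

theorem norm_single (k : ℕ) (v : X k) : ‖single e k v‖ = ‖v‖ := by
  have h1 := (uTerm_hasSum_iff.1 (hasSum_uTerm_of_eventually_zero e (x := (single e k v).1)
    (N := k + 1) fun n hn => Pi.single_eq_of_ne (by omega) v)).norm
  rw [tendsto_nhds_unique (tendsto_norm e X (single e k v)) h1, Finset.sum_eq_single k]
  · simp [uTerm, norm_smul, e.norm_basis]
  · intro n _ hn
    simp [uTerm, Pi.single_eq_of_ne hn]
  · simp

/-- The isometric embedding of `X k` into the direct sum. -/
noncomputable def singleL (k : ℕ) : X k →L[𝕜] USum e X :=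
  LinearMap.mkContinuous
    { toFun := single e k
      map_add' := fun v w => Subtype.ext (Pi.single_add k v w)
      map_smul' := fun c v => Subtype.ext (Pi.single_smul k c v) } 1
    fun v => ((norm_single e k v).trans (one_mul _).symm).le

@[simp]
theorem singleL_apply (k : ℕ) (v : X k) : singleL e k v = single e k v := rfl

theorem sum_single_val (x : ∀ n, X n) (N n : ℕ) :
    (∑ k ∈ Finset.range N, single e k (x k)).1 n = if n < N then x n else 0 := by
  have hval : ∀ s : Finset ℕ, (∑ k ∈ s, single e k (x k)).1 = ∑ k ∈ s, Pi.single k (x k) := by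
    intro s
    induction s using Finset.induction_on with
    | empty => rfl
    | insert k s hk ih =>
      rw [Finset.sum_insert hk, Finset.sum_insert hk, ← ih]
      rfl
  rw [hval, Finset.sum_apply]
  simp [Finset.sum_pi_single]

theorem norm_sum_single (x : ∀ n, X n) (N : ℕ) :
    ‖∑ k ∈ Finset.range N, single e k (x k)‖ = ‖∑ k ∈ Finset.range N, uTerm e x k‖ := by
  have h1 := (uTerm_hasSum_iff.1 (hasSum_uTerm_of_eventually_zero e
    (x := (∑ k ∈ Finset.range N, single e k (x k)).1) (N := N) fun n hn => by
      rw [sum_single_val, if_neg hn.not_gt])).norm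
  rw [tendsto_nhds_unique (tendsto_norm e X _) h1]
  congr 1
  refine Finset.sum_congr rfl fun n hn => ?_
  simp [uTerm, sum_single_val, Finset.mem_range.1 hn]

theorem tendsto_sum_single (x : USum e X) :
    Tendsto (fun N => ∑ k ∈ Finset.range N, single e k (x.1 k)) atTop (𝓝 x) := by
  have hsum := uTerm_hasSum_iff.1 (Summable.hasSum x.2)
  rw [Metric.tendsto_atTop]
  intro δ hδ
  obtain ⟨N, hN⟩ := Metric.cauchySeq_iff.1 hsum.cauchySeq (δ / 2) (by positivity)
  refine ⟨N, fun M hM => ?_⟩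
  rw [dist_comm, dist_eq_norm]
  refine (le_of_tendsto (tendsto_norm e X (x - ∑ k ∈ Finset.range M, single e k (x.1 k)))
    ?_).trans_lt (half_lt_self hδ)
  filter_upwards [eventually_ge_atTop M] with K hK
  have h := (hN K (hM.trans hK) M hM).le
  rw [dist_eq_norm, ← Finset.sum_Ico_eq_sub _ hK] at h
  refine le_trans (le_of_eq ?_) h
  rw [← Finset.sum_range_add_sum_Ico _ hK, Finset.sum_eq_zero, zero_add]
  · congr 1
    refine Finset.sum_congr rfl fun n hn => ?_
    have : (x - ∑ k ∈ Finset.range M, single e k (x.1 k)).1 n = x.1 n := by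
      change x.1 n - (∑ k ∈ Finset.range M, single e k (x.1 k)).1 n = x.1 n
      rw [sum_single_val, if_neg (Finset.mem_Ico.1 hn).1.not_gt, sub_zero]
    simp [uTerm, this]
  · intro n hn
    have : (x - ∑ k ∈ Finset.range M, single e k (x.1 k)).1 n = 0 := by
      change x.1 n - (∑ k ∈ Finset.range M, single e k (x.1 k)).1 n = 0
      rw [sum_single_val, if_pos (Finset.mem_range.1 hn), sub_self]
    simp [uTerm, this]

/-- The norm of a functional on the direct sum is determined by finitely supported vectors. -/
theorem opNorm_le_of_sum_single (F : StrongDual 𝕜 (USum e X)) {C : ℝ} (hC : 0 ≤ C)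
    (h : ∀ (x : ∀ n, X n) (N : ℕ),
      ∑ n ∈ Finset.range N, ‖F (single e n (x n))‖ ≤
        C * ‖∑ n ∈ Finset.range N, (‖x n‖ : 𝕜) • e.toSchauder n‖) : ‖F‖ ≤ C := by
  refine F.opNorm_le_bound hC fun x => ?_
  refine le_of_tendsto_of_tendsto' ((F.continuous.tendsto x).comp (tendsto_sum_single e x)).norm
    ((tendsto_norm e X x).const_mul C) fun N => ?_
  rw [Function.comp_apply, map_sum]
  exact (norm_sum_le _ _).trans (h x.1 N)

/-! ### Factorization of functionals on the direct sum -/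

variable (X) in
/-- Factorizations of functionals `F` in the dual ball of the direct sum: the restriction of `F` to
the `n`-th summand is `4 t(e_n) z_n`, with `t` in the dual ball of `U` and `z_n` in the dual ball
of `X n`. -/
def factorizations : Set (DualBall 𝕜 U × (∀ n, DualBall 𝕜 (X n)) × DualBall 𝕜 (USum e X)) :=
  ⋂ (n : ℕ) (v : X n), {q | q.2.2.toDual (single e n v) =
    4 * (q.1.toDual (e.toSchauder n) * (q.2.1 n).toDual v)}

theorem isClosed_factorizations : IsClosed (factorizations e X) := by
  refine isClosed_iInter fun n => isClosed_iInter fun v => isClosed_eq ?_ ?_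
  · exact (DualBall.continuous_eval _).comp (continuous_snd.comp continuous_snd)
  · exact continuous_const.mul (((DualBall.continuous_eval _).comp continuous_fst).mul
      ((DualBall.continuous_eval v).comp
        ((continuous_apply n).comp (continuous_fst.comp continuous_snd))))

variable (X) in
/-- The space of factorizations of functionals in the dual ball of the direct sum. -/
abbrev Factorization : Type _ := ↥(factorizations e X)

instance : CompactSpace (Factorization e X) :=
  isCompact_iff_compactSpace.1 (isClosed_factorizations e).isCompact

/-- Test F on multiples of vectors w_n that norm its restrictions up to a factor 2; replacing the
coordinates of u by their moduli costs another 2. Hence the constant 4 in the factorizations. -/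
theorem sum_norm_comp_single_mul_le (F : DualBall 𝕜 (USum e X)) (N : ℕ) (u : U) :
    ‖∑ n ∈ Finset.range N, (‖F.toDual ∘L singleL e n‖ : 𝕜) * e.toSchauder.coord n u‖ ≤
      4 * ‖u‖ := by
  have hw : ∀ n, ∃ w : X n, ‖w‖ ≤ 1 ∧
      ‖F.toDual ∘L singleL e n‖ ≤ 2 * ‖F.toDual (single e n w)‖ := by
    intro n
    rcases (norm_nonneg (F.toDual ∘L singleL e n)).eq_or_lt with h | h
    · exact ⟨0, by simp, by rw [← h]; positivity⟩
    · obtain ⟨w, hw, hlt⟩ := (F.toDual ∘L singleL e n).exists_lt_apply_of_lt_opNorm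
        (half_lt_self h)
      refine ⟨w, hw.le, ?_⟩
      rw [ContinuousLinearMap.comp_apply, singleL_apply] at hlt
      linarith
  choose w hw1 hw2 using hw
  set a : ℕ → ℝ := fun n => ‖e.toSchauder.coord n u‖ with ha
  set x : ∀ n, X n := fun n => ((a n : 𝕜) * conjPhase (F.toDual (single e n (w n)))) • w n with hx
  have hFx : ∀ n, F.toDual (single e n (x n)) =
      ((a n * ‖F.toDual (single e n (w n))‖ : ℝ) : 𝕜) := by
    intro n
    rw [← singleL_apply, hx, map_smul, map_smul, smul_eq_mul, singleL_apply, mul_assoc,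
      conjPhase_mul]
    push_cast
    rfl
  have hxa : ∀ n, ‖x n‖ ≤ a n := by
    intro n
    rw [hx, norm_smul, norm_mul, RCLike.norm_ofReal, abs_of_nonneg (norm_nonneg _), mul_assoc]
    exact mul_le_of_le_one_right (norm_nonneg _)
      (mul_le_one₀ (norm_conjPhase_le _) (norm_nonneg _) (hw1 n))
  have h1 : ∑ n ∈ Finset.range N, a n * ‖F.toDual (single e n (w n))‖ ≤
      ‖∑ n ∈ Finset.range N, single e n (x n)‖ := by
    have h := F.toDual.le_of_opNorm_le F.norm_toDual_le (∑ n ∈ Finset.range N, single e n (x n))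
    rw [map_sum, Finset.sum_congr rfl fun n _ => hFx n, ← RCLike.ofReal_sum, RCLike.norm_ofReal,
      one_mul] at h
    exact (le_abs_self _).trans h
  have h2 : ‖∑ n ∈ Finset.range N, single e n (x n)‖ ≤ 2 * ‖u‖ := by
    rw [norm_sum_single]
    refine (e.norm_sum_mono _ (fun n => ‖x n‖) a (fun n => norm_nonneg _) hxa).trans ?_
    refine (e.norm_sum_norm_le _ _).trans ?_
    have := e.norm_proj_apply_le (Finset.range N) u
    rw [GeneralSchauderBasis.proj_apply] at this
    linarith
  calc _ ≤ ∑ n ∈ Finset.range N, ‖F.toDual ∘L singleL e n‖ * a n := by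
        refine (norm_sum_le _ _).trans (le_of_eq (Finset.sum_congr rfl fun n _ => ?_))
        rw [norm_mul, RCLike.norm_ofReal, abs_norm]
    _ ≤ ∑ n ∈ Finset.range N, 2 * (a n * ‖F.toDual (single e n (w n))‖) := by
        refine Finset.sum_le_sum fun n _ => ?_
        have := mul_le_mul_of_nonneg_right (hw2 n) (norm_nonneg (e.toSchauder.coord n u))
        simp only [ha]
        linarith
    _ ≤ 4 * ‖u‖ := by
        rw [← Finset.mul_sum]
        linarith

/-- Finite truncations of the desired functional lie in the dual ball by the preceding estimate. A
weak* limit along an ultrafilter works, since each value at a basis vector is eventually constant.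
-/
theorem exists_dualBall_apply_basis (F : DualBall 𝕜 (USum e X)) :
    ∃ t : DualBall 𝕜 U, ∀ n,
      4 * t.toDual (e.toSchauder n) = (‖F.toDual ∘L singleL e n‖ : 𝕜) := by
  set T : ℕ → StrongDual 𝕜 U := fun N =>
    (4⁻¹ : 𝕜) • ∑ n ∈ Finset.range N, (‖F.toDual ∘L singleL e n‖ : 𝕜) • e.toSchauder.coord n
    with hT
  have hTapp : ∀ N u, T N u = 4⁻¹ *
      ∑ n ∈ Finset.range N, (‖F.toDual ∘L singleL e n‖ : 𝕜) * e.toSchauder.coord n u := by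
    intro N u
    simp [hT, sum_apply]
  have hTle : ∀ N, ‖T N‖ ≤ 1 := fun N => (T N).opNorm_le_bound zero_le_one fun u => by
    rw [hTapp, norm_mul, norm_inv, RCLike.norm_ofNat]
    have := sum_norm_comp_single_mul_le e F N u
    linarith
  set G := (hyperfilter ℕ).map fun N => DualBall.mk (T N) (hTle N) with hG
  have hlim : Tendsto (fun N => DualBall.mk (T N) (hTle N)) (hyperfilter ℕ) (𝓝 G.lim) :=
    G.le_nhds_lim
  refine ⟨G.lim, fun n => ?_⟩
  have h1 := (DualBall.tendsto_iff.1 hlim (e.toSchauder n)).const_mul 4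
  refine tendsto_nhds_unique h1 (tendsto_const_nhds.congr' ?_)
  have hge : ∀ᶠ N in (hyperfilter ℕ : Filter ℕ), n < N :=
    (Nat.cofinite_eq_atTop ▸ hyperfilter_le_cofinite) (eventually_gt_atTop n)
  filter_upwards [hge] with N hN
  rw [DualBall.toDual_mk, hTapp, Finset.sum_eq_single n]
  · rw [e.toSchauder.ortho]
    simp
  · intro m _ hm
    simp [e.toSchauder.ortho, hm]
  · exact fun h => absurd (Finset.mem_range.2 hN) h

namespace Factorization

/-- The functional on `U` of a factorization. -/
def outer (q : Factorization e X) : DualBall 𝕜 U := q.1.1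

/-- The functionals on the summands of a factorization. -/
def inner (q : Factorization e X) (n : ℕ) : DualBall 𝕜 (X n) := q.1.2.1 n

/-- The functional that is factorized. -/
def target (q : Factorization e X) : DualBall 𝕜 (USum e X) := q.1.2.2

variable {e}

theorem target_single (q : Factorization e X) (n : ℕ) (v : X n) :
    (target e q).toDual (single e n v) =
      4 * ((outer e q).toDual (e.toSchauder n) * (inner e q n).toDual v) :=
  Set.mem_iInter₂.1 q.2 n v

theorem continuous_outer : Continuous (outer e : Factorization e X → _) :=
  continuous_fst.comp continuous_subtype_val

theorem continuous_inner (n : ℕ) : Continuous fun q : Factorization e X => inner e q n :=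
  (continuous_apply n).comp (continuous_fst.comp (continuous_snd.comp continuous_subtype_val))

theorem continuous_target : Continuous (target e : Factorization e X → _) :=
  continuous_snd.comp (continuous_snd.comp continuous_subtype_val)

theorem surjective_target : Function.Surjective (target e : Factorization e X → _) := by
  intro F
  obtain ⟨t, ht⟩ := exists_dualBall_apply_basis e F
  -- A zero restriction is normalized to 0, because the inverse of 0 is 0.
  have hz : ∀ n, ‖(‖F.toDual ∘L singleL e n‖⁻¹ : 𝕜) • (F.toDual ∘L singleL e n)‖ ≤ 1 := by
    intro n
    rw [norm_smul, norm_inv, RCLike.norm_ofReal, abs_norm]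
    exact inv_mul_le_one
  refine ⟨⟨⟨t, fun n => DualBall.mk _ (hz n), F⟩, Set.mem_iInter₂.2 fun n v => ?_⟩, rfl⟩
  rw [Set.mem_ofPred_eq, DualBall.toDual_mk, ← mul_assoc, ht, smul_apply, smul_eq_mul,
    ← mul_assoc, ContinuousLinearMap.comp_apply, singleL_apply]
  by_cases h : ‖F.toDual ∘L singleL e n‖ = 0
  · have h0 : (F.toDual ∘L singleL e n) v = 0 := by
      rw [norm_eq_zero.1 h]
      rfl
    rw [ContinuousLinearMap.comp_apply, singleL_apply] at h0
    rw [h0, mul_zero]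
  · rw [mul_inv_cancel₀ (by simpa using h), one_mul]

/-- The distance of two factorized functionals is controlled by the distance of their outer
functionals, the distances of finitely many inner functionals, and a tail estimate. -/
theorem norm_target_sub_le {q q' : Factorization e X} {N : ℕ} {δ η : ℝ} (hδ : 0 ≤ δ) (hη : 0 ≤ η)
    (ht : ‖(outer e q').toDual - (outer e q).toDual‖ ≤ δ)
    (hz : ∀ n < N, ‖(inner e q' n).toDual - (inner e q n).toDual‖ ≤ δ)
    (htail : e.TailLE (outer e q).toDual N η) :
    ‖(target e q').toDual - (target e q).toDual‖ ≤ 16 * δ + 8 * η := by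
  refine opNorm_le_of_sum_single e _ (by positivity) fun x M => ?_
  set V := ‖∑ n ∈ Finset.range M, (‖x n‖ : 𝕜) • e.toSchauder n‖ with hV
  set t := (outer e q).toDual with ht_def
  set t' := (outer e q').toDual with ht'_def
  have hV0 : 0 ≤ V := norm_nonneg _
  -- Split t'z' - tz as (t' - t)z' + t(z' - z), and use only ‖z' - z‖ ≤ 2 beyond N. After summation
  -- the three parts contribute 4(2δ + 2δ + 2η).
  have hterm : ∀ n, ‖((target e q').toDual - (target e q).toDual) (single e n (x n))‖ ≤
      4 * (‖(t' - t) (e.toSchauder n)‖ * ‖x n‖ +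
        ((if n < N then δ else 0) * (‖t (e.toSchauder n)‖ * ‖x n‖) +
          if n < N then 0 else 2 * (‖t (e.toSchauder n)‖ * ‖x n‖))) := by
    intro n
    have hdec : ((target e q').toDual - (target e q).toDual) (single e n (x n)) =
        4 * ((t' - t) (e.toSchauder n) * (inner e q' n).toDual (x n) +
          t (e.toSchauder n) * ((inner e q' n).toDual - (inner e q n).toDual) (x n)) := by
      rw [sub_apply, target_single, target_single, sub_apply, sub_apply]
      ring
    rw [hdec, norm_mul, RCLike.norm_ofNat]
    refine mul_le_mul_of_nonneg_left ((norm_add_le _ _).trans (add_le_add ?_ ?_)) (by norm_num)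
    · rw [norm_mul]
      gcongr
      simpa using (inner e q' n).toDual.le_of_opNorm_le (inner e q' n).norm_toDual_le (x n)
    · rw [norm_mul]
      split_ifs with hn
      · have := ((inner e q' n).toDual - (inner e q n).toDual).le_of_opNorm_le (hz n hn) (x n)
        calc _ ≤ ‖t (e.toSchauder n)‖ * (δ * ‖x n‖) := by gcongr
          _ = _ := by ring
      · have h2 : ‖(inner e q' n).toDual - (inner e q n).toDual‖ ≤ 2 := by
          have h3 := norm_sub_le (inner e q' n).toDual (inner e q n).toDual
          have h4 := (inner e q' n).norm_toDual_le
          have h5 := (inner e q n).norm_toDual_le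
          linarith
        have := ((inner e q' n).toDual - (inner e q n).toDual).le_of_opNorm_le h2 (x n)
        calc _ ≤ ‖t (e.toSchauder n)‖ * (2 * ‖x n‖) := by gcongr
          _ = _ := by ring
  have hA : ∑ n ∈ Finset.range M, ‖(t' - t) (e.toSchauder n)‖ * ‖x n‖ ≤ 2 * δ * V :=
    (e.sum_norm_apply_mul_le (t' - t) _ (fun n => ‖x n‖) fun n => norm_nonneg _).trans
      (by gcongr)
  have hB : ∑ n ∈ Finset.range M, (if n < N then δ else 0) * (‖t (e.toSchauder n)‖ * ‖x n‖) ≤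
      2 * δ * V := by
    calc _ ≤ ∑ n ∈ Finset.range M, δ * (‖t (e.toSchauder n)‖ * ‖x n‖) := by
          refine Finset.sum_le_sum fun n _ => ?_
          gcongr
          split_ifs <;> simp [hδ]
      _ ≤ δ * (2 * ‖t‖ * V) := by
          rw [← Finset.mul_sum]
          gcongr
          exact e.sum_norm_apply_mul_le t _ (fun n => ‖x n‖) fun n => norm_nonneg _
      _ ≤ δ * (2 * 1 * V) := by
          gcongr
          exact (outer e q).norm_toDual_le
      _ = 2 * δ * V := by ring
  have hC : ∑ n ∈ Finset.range M, (if n < N then 0 else 2 * (‖t (e.toSchauder n)‖ * ‖x n‖)) ≤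
      2 * η * V := by
    calc _ = 2 * ∑ n ∈ Finset.range M with ¬ n < N, ‖t (e.toSchauder n)‖ * ‖x n‖ := by
          rw [Finset.mul_sum, Finset.sum_filter]
          refine Finset.sum_congr rfl fun n _ => ?_
          split_ifs <;> simp_all
      _ ≤ 2 * (η * ‖∑ n ∈ Finset.range M with ¬ n < N, (‖x n‖ : 𝕜) • e.toSchauder n‖) := by
          gcongr
          exact htail _ (fun n => ‖x n‖) (fun n hn => not_lt.1 (Finset.mem_filter.1 hn).2)
            fun n => norm_nonneg _
      _ ≤ 2 * (η * V) := by
          gcongr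
          exact e.norm_sum_filter_le _ _ (fun n => ‖x n‖) fun n => norm_nonneg _
      _ = 2 * η * V := by ring
  calc _ ≤ ∑ n ∈ Finset.range M, 4 * (‖(t' - t) (e.toSchauder n)‖ * ‖x n‖ +
        ((if n < N then δ else 0) * (‖t (e.toSchauder n)‖ * ‖x n‖) +
          if n < N then 0 else 2 * (‖t (e.toSchauder n)‖ * ‖x n‖))) :=
        Finset.sum_le_sum fun n _ => hterm n
    _ ≤ 4 * (2 * δ * V + (2 * δ * V + 2 * η * V)) := by
        rw [← Finset.mul_sum, Finset.sum_add_distrib, Finset.sum_add_distrib]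
        gcongr
    _ = (16 * δ + 8 * η) * V := by ring

end Factorization

end USum

/-! ### Combining the ranks -/

section Main

variable {𝕜 : Type*} [RCLike 𝕜] {U : Type*} [NormedAddCommGroup U] [NormedSpace 𝕜 U]
  {e : NormalizedOneUnconditionalBasis 𝕜 U}

/-- Near t, functionals of the same rank are within δ of t, so a tail bound δ for t becomes δ + 2δ
for them. Choosing N least among cutoffs valid on a neighbourhood within the level set makes N upper
semicontinuous there. -/
theorem exists_locally_uniform_tailLE {δ : ℝ} {ρ : DualBall 𝕜 U → Ordinal.{0}}
    (hρ : IsSzlenkRank δ ρ) : ∃ N : DualBall 𝕜 U → ℕ,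
      (∀ t, e.TailLE t.toDual (N t) (3 * δ)) ∧
      ∀ t, ∀ᶠ t' in 𝓝 t, ρ t' = ρ t → N t' ≤ N t := by
  classical
  have hex : ∀ t, ∃ N, ∀ᶠ t' in 𝓝 t, ρ t' = ρ t → e.TailLE t'.toDual N (3 * δ) := by
    intro t
    obtain ⟨N, hN⟩ := e.exists_tailLE hρ t
    refine ⟨N, (hρ t).mono fun t' ht' heq => ?_⟩
    rw [show 3 * δ = δ + 2 * δ by ring]
    exact hN.add (ht'.2 heq)
  refine ⟨fun t => Nat.find (hex t), fun t => (Nat.find_spec (hex t)).self_of_nhds rfl,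
    fun t => ?_⟩
  filter_upwards [eventually_eventually_nhds.2 (Nat.find_spec (hex t))] with t' ht' heq
  exact Nat.find_min' _ (heq.symm ▸ ht')

variable [CompleteSpace U]
  {X : ℕ → Type*} [∀ n, NormedAddCommGroup (X n)] [∀ n, NormedSpace 𝕜 (X n)]

/-- Rank functions on the dual balls of `U` and of the summands combine to a rank function on the
dual ball of the direct sum. -/
theorem USum.exists_isSzlenkRank {δ : ℝ} (hδ : 0 ≤ δ) {θ β : Ordinal.{0}}
    (hθ : Ordinal.IsPrincipal (· + ·) θ) (hθ0 : 0 < θ)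
    {ρ : DualBall 𝕜 U → Ordinal.{0}} (hρ : IsSzlenkRank δ ρ) (hρβ : ∀ t, ρ t < β)
    {r : ∀ n, DualBall 𝕜 (X n) → Ordinal.{0}} (hr : ∀ n, IsSzlenkRank δ (r n))
    (hrθ : ∀ n z, r n z < θ) :
    ∃ R : DualBall 𝕜 (USum e X) → Ordinal.{0}, (∀ f, R f < θ * β) ∧ IsSzlenkRank (40 * δ) R := by
  obtain ⟨N, hNtail, hNle⟩ := exists_locally_uniform_tailLE (e := e) hρ
  set S : USum.Factorization e X → ℕ → Ordinal.{0} := fun q =>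
    Ordinal.hessenbergSum fun n => r n (USum.Factorization.inner e q n) with hS
  have hSθ : ∀ q n, S q n < θ := fun q n => hθ.hessenbergSum_lt hθ0 (fun n => hrθ n _) n
  -- The order is lexicographic: a drop of the outer rank outweighs any change of the inner sum,
  -- including one caused by a longer cutoff.
  have hstep : ∀ (a b c d : Ordinal.{0}), a < b → c < θ → θ * a + c < θ * b + d := by
    intro a b c d hab hc
    calc θ * a + c < θ * a + θ := by gcongr
      _ = θ * (a + 1) := (mul_add_one _ _).symm
      _ ≤ θ * b := by gcongr; exact Order.add_one_le_of_lt hab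
      _ ≤ θ * b + d := le_self_add
  refine exists_isSzlenkRank_of_surjective (p := USum.Factorization.target e (X := X))
    USum.Factorization.continuous_target USum.Factorization.surjective_target
    (R := fun q => θ * ρ (USum.Factorization.outer e q) + S q (N (USum.Factorization.outer e q)))
    (fun q => ?_) (fun q => by simpa using hstep _ _ _ 0 (hρβ _) (hSθ q _))
  have h1 := (USum.Factorization.continuous_outer.tendsto q).eventually
    ((hρ (USum.Factorization.outer e q)).and (hNle (USum.Factorization.outer e q)))
  have h2 : ∀ᶠ q' in 𝓝 q, ∀ n ∈ Finset.range (N (USum.Factorization.outer e q)),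
      r n (USum.Factorization.inner e q' n) ≤ r n (USum.Factorization.inner e q n) ∧
      (r n (USum.Factorization.inner e q' n) = r n (USum.Factorization.inner e q n) →
        ‖(USum.Factorization.inner e q' n).toDual - (USum.Factorization.inner e q n).toDual‖ ≤ δ) :=
    (Filter.eventually_all_finset _).2 fun n _ =>
      ((USum.Factorization.continuous_inner n).tendsto q).eventually
        (hr n (USum.Factorization.inner e q n))
  filter_upwards [h1, h2] with q' hq' hin
  obtain ⟨⟨hle, hdist⟩, hN⟩ := hq'
  rcases hle.lt_or_eq with hlt | heq
  · have := hstep _ _ _ (S q (N (USum.Factorization.outer e q))) hlt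
      (hSθ q' (N (USum.Factorization.outer e q')))
    exact ⟨this.le, fun h => absurd h this.ne⟩
  · have hin' : ∀ n < N (USum.Factorization.outer e q),
        r n (USum.Factorization.inner e q' n) ≤ r n (USum.Factorization.inner e q n) :=
      fun n hn => (hin n (Finset.mem_range.2 hn)).1
    have hS1 : S q' (N (USum.Factorization.outer e q')) ≤ S q' (N (USum.Factorization.outer e q)) :=
      Ordinal.monotone_hessenbergSum _ (hN heq)
    have hS2 : S q' (N (USum.Factorization.outer e q)) ≤ S q (N (USum.Factorization.outer e q)) :=
      Ordinal.hessenbergSum_le hin'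
    simp only [heq, add_le_add_iff_left]
    refine ⟨hS1.trans hS2, fun h => ?_⟩
    -- Equality of the total ranks collapses the chain `hS1`, `hS2`, so no inner rank below the
    -- cutoff has dropped. The resulting distance bound is 16δ + 8·3δ = 40δ.
    have hS3 := Ordinal.eq_of_hessenbergSum_eq hin'
      (le_antisymm hS2 (((add_le_add_iff_left _).1 h.ge).trans hS1))
    have := USum.Factorization.norm_target_sub_le hδ (by positivity) (hdist heq)
      (fun n hn => (hin n (Finset.mem_range.2 hn)).2 (hS3 n hn))
      (hNtail (USum.Factorization.outer e q))
    linarith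

end Main

theorem theorem5p8 {𝕜 : Type*} [RCLike 𝕜]
    {U : Type*} [NormedAddCommGroup U] [NormedSpace 𝕜 U] [CompleteSpace U]
    (e : NormalizedOneUnconditionalBasis 𝕜 U)
    (X : ℕ → Type*) [∀ n, NormedAddCommGroup (X n)] [∀ n, NormedSpace 𝕜 (X n)]
    [∀ n, CompleteSpace (X n)] [∀ n, TopologicalSpace.SeparableSpace (X n)] :
    szlenkIndex 𝕜 (USum e X) ≤ (⨆ n, szlenkIndex 𝕜 (X n)) * szlenkIndex 𝕜 U := by
  set θ := ⨆ n, szlenkIndex 𝕜 (X n) with hθ_def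
  set β := szlenkIndex 𝕜 U with hβ_def
  have hXθ : ∀ n, szlenkIndex 𝕜 (X n) ≤ θ := Ordinal.le_iSup fun n => szlenkIndex 𝕜 (X n)
  have hθ0 : 0 < θ := (szlenkIndex_pos 𝕜 (X 0)).trans_le (hXθ 0)
  have hβ0 : 0 < β := szlenkIndex_pos 𝕜 U
  have hle := szlenkIndex_le_omega_one 𝕜 (USum e X)
  -- No index exceeds ω₁ and both factors are positive, so an uncountable factor already gives the
  -- bound.
  rcases lt_or_ge θ ω₁ with hθ | hθ
  swap
  · exact hle.trans (hθ.trans (Ordinal.le_mul_left θ hβ0))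
  rcases lt_or_ge β ω₁ with hβ | hβ
  swap
  · exact hle.trans (hβ.trans (Ordinal.le_mul_right β hθ0))
  refine szlenkSet_le fun ε hε => szlenkEps_le ?_
  -- 80 = 2 · 40: the combined rank loses a factor 40, and passing from radius to diameter loses 2.
  have hδ : 0 < ε / 80 := by positivity
  obtain ⟨ρ, hρβ, hρ⟩ := exists_isSzlenkRank hδ.le (szlenkDerivative_eq_empty
    (isWeakStarClosed_closedBall (𝕜 := 𝕜) (X := U) 1) hβ (szlenkEps_le_szlenkSet hδ _))
  choose r hrθ hr using fun n => exists_isSzlenkRank hδ.le (szlenkDerivative_eq_empty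
    (isWeakStarClosed_closedBall (𝕜 := 𝕜) (X := X n) 1) hθ
    ((szlenkEps_le_szlenkSet hδ _).trans (hXθ n)))
  obtain ⟨R, hRlt, hR⟩ := USum.exists_isSzlenkRank (e := e) hδ.le
    (Ordinal.IsPrincipal.iSup fun n => isPrincipal_add_szlenkIndex 𝕜 (X n)) hθ0 hρ hρβ hr hrθ
  have := hR.szlenkDerivative_eq_empty hRlt
  rwa [show 2 * (40 * (ε / 80)) = ε by ring] at this
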